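/- Let $p,q>1$ be relatively prime integers. A strictly chained $(p,q)$-ary partition of an integer $U\ge 0$ is a finite set of distinct integers of the form $p^aq^b$ ($a,b\ge 0$) with sum $U$, such that for any two of them one divides the other. Let $W(U)$ be the number of such partitions of $U$, and let $S(x)=\sum_{1\le U\le x}W(U)$ for real $x$. Then the equation $$\frac1{p^\alpha}+\frac1{q^\alpha}-\frac1{(pq)^\alpha}=\frac12$$ has a unique positive real solution $\alpha$, and $$S(x)=C_{p,q}\,x^\alpha\,(1+o(1))\qquad(x\to\infty),$$ where $C_{p,q}$ is a positive constant satisfying $$C_{p,q}<2\left(\frac{\ln p^\alpha}{p^\alpha-1}+\frac{\ln q^\alpha}{q^\alpha-1}\right)^{-1}.$$ Moreover $C_{p,q}$ is computable: there is an algorithm that, given relatively prime integers $p,q>1$ and $n\in\mathbb{N}$, outputs an integer $m$ with $|C_{p,q}-m/2^n|\le 2^{-n}$. -/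

import Mathlib

open scoped Asymptotics

/-- A strictly chained `(p,q)`-ary partition of `U`, given by its (distinct) parts: every part has
the form `p ^ a * q ^ b`, the parts form a chain for divisibility, and they sum up to `U`.
The empty partition is the one of `0`. -/
def IsChainedPartition (p q U : ℕ) (s : Finset ℕ) : Prop :=
  (∀ n ∈ s, ∃ a b : ℕ, n = p ^ a * q ^ b) ∧ IsChain (· ∣ ·) (s : Set ℕ) ∧ ∑ n ∈ s, n = U

/-- The set `Ω(U)` of all strictly chained `(p,q)`-ary partitions of `U`. -/
def chainedPartitions (p q U : ℕ) : Set (Finset ℕ) :=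
  {s | IsChainedPartition p q U s}

theorem chainedPartitions_finite (p q U : ℕ) : (chainedPartitions p q U).Finite := by
  refine (Finset.finite_toSet (Finset.range (U + 1)).powerset).subset ?_
  intro s hs
  rw [Finset.mem_coe, Finset.mem_powerset]
  intro n hn
  have h : n ≤ ∑ m ∈ s, m := Finset.single_le_sum (f := fun m : ℕ => m) (fun _ _ => Nat.zero_le _) hn
  have h2 : ∑ m ∈ s, m = U := hs.2.2
  rw [Finset.mem_range]
  omega

/-- The number `W(U)` of strictly chained `(p,q)`-ary partitions of `U`. -/
noncomputable def chainedCount (p q U : ℕ) : ℕ :=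
  (chainedPartitions p q U).ncard

/-- The summatory function `S(x) = ∑_{1 ≤ U ≤ x} W(U)`. -/
noncomputable def chainedSum (p q : ℕ) (x : ℝ) : ℝ :=
  ∑ U ∈ Finset.Icc 1 ⌊x⌋₊, (chainedCount p q U : ℝ)

/-- A family of real numbers is (uniformly) computable on `D` if some algorithm (a computable
function) outputs, for every index `i ∈ D` and every precision `n`, the numerator of a dyadic
rational with denominator `2 ^ n` within distance `2 ^ (-n)` of the number. In particular each
single `c i` with `i ∈ D` is a computable real number. -/
def IsComputableRealOn {ι : Type*} [Primcodable ι] (D : Set ι) (c : ι → ℝ) : Prop :=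
  ∃ f : ι × ℕ → ℤ, Computable f ∧
    ∀ i ∈ D, ∀ n : ℕ, |c i - (f (i, n) : ℝ) / 2 ^ n| ≤ 1 / 2 ^ n

/-- The admissible pairs: relatively prime integers greater than `1`. -/
def admissiblePairs : Set (ℕ × ℕ) :=
  {pq | 1 < pq.1 ∧ 1 < pq.2 ∧ Nat.Coprime pq.1 pq.2}

/-- `α` is a positive solution of `1 / p ^ α + 1 / q ^ α - 1 / (p q) ^ α = 1 / 2`. -/
def IsPositiveExponent (p q : ℕ) (α : ℝ) : Prop :=
  0 < α ∧ 1 / (p : ℝ) ^ α + 1 / (q : ℝ) ^ α - 1 / ((p : ℝ) * (q : ℝ)) ^ α = 1 / 2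

/-! Let T(n) count the chains with sum at most n, and Q(n) those with a part not divisible by p. A
chain without the part 1 either has all parts divisible by p, or has a part prime to p and then all
parts divisible by q; dividing out, and deleting the part 1 when it occurs, gives recursions for T
and Q. Up to a shift of the argument by 1 they read T(y) ≈ 2T(y/p) + 2Q(y/q) and Q(y) ≈ T(y/p) +
2Q(y/q). The equation for α says exactly that the pair y^α, (1 - p^(-α)) y^α solves the unshifted
system.

Upper and lower bounds by multiples of this solution propagate from a bounded window to infinity
(`upper_extend`, `lower_extend`). Let C be the infimum of the eventual upper constants.
Near-equality at some large y is inherited by y/p and y/q, hence by all y/(p^i q^j)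
(`nearTop_iterate`). As log p / log q is irrational, the numbers p^i q^j have ratios of neighbours
tending to 1, so monotonicity gives near-equality on a whole window, and every B < C is an eventual
lower constant (`exists_limit`).

In the logarithmic scale, a weighted integral of T and Q over windows of lengths log p and log q
never exceeds its value at the start, where T = 1 and Q = 0 (`logScale_integral_le`). This bounds C.

Since a finite window controls C, finitely many integer inequalities certify an approximation of C.
Such a certificate exists for every precision (`exists_isCertificate`), and an unbounded search
finds it. -/

/-! ### Chains and the recursions for their counts -/

/-- The finite sets of numbers `p ^ a * q ^ b` that are chains for divisibility. -/
def chainFamily (p q : ℕ) : Set (Finset ℕ) :=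
  {s | (∀ n ∈ s, ∃ a b : ℕ, n = p ^ a * q ^ b) ∧ IsChain (· ∣ ·) (s : Set ℕ)}

/-- The chains with sum at most `n`. -/
def boundedChains (p q n : ℕ) : Set (Finset ℕ) :=
  {s | s ∈ chainFamily p q ∧ ∑ x ∈ s, x ≤ n}

/-- The chains with sum at most `n` and with a part that is not divisible by `p`. -/
def primitiveChains (p q n : ℕ) : Set (Finset ℕ) :=
  {s | s ∈ boundedChains p q n ∧ ∃ x ∈ s, ¬ p ∣ x}

/-- The number of chains with sum at most `n`. -/
noncomputable def chainCount (p q n : ℕ) : ℕ := (boundedChains p q n).ncard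

/-- The number of chains with sum at most `n` and with a part that is not divisible by `p`. -/
noncomputable def primitiveCount (p q n : ℕ) : ℕ := (primitiveChains p q n).ncard

/-- Multiplication of all parts by `c`. -/
def scaleParts (c : ℕ) (s : Finset ℕ) : Finset ℕ := s.image (c * ·)

theorem scaleParts_injective {c : ℕ} (hc : 0 < c) : Function.Injective (scaleParts c) :=
  Finset.image_injective (mul_right_injective₀ hc.ne')

theorem sum_scaleParts {c : ℕ} (hc : 0 < c) (s : Finset ℕ) :
    ∑ x ∈ scaleParts c s, x = c * ∑ x ∈ s, x := by
  rw [scaleParts, Finset.sum_image fun x _ y _ h => mul_right_injective₀ hc.ne' h, Finset.mul_sum]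

theorem chainFamily_comm (p q : ℕ) : chainFamily p q = chainFamily q p := by
  ext s
  simp only [chainFamily, Set.mem_ofPred_eq]
  refine and_congr_left fun _ => forall₂_congr fun n _ => ?_
  rw [exists_comm]
  simp only [mul_comm]

theorem boundedChains_finite (p q n : ℕ) : (boundedChains p q n).Finite := by
  refine (Finset.finite_toSet (Finset.range (n + 1)).powerset).subset fun s hs => ?_
  rw [Finset.mem_coe, Finset.mem_powerset]
  intro x hx
  have h : x ≤ ∑ m ∈ s, m :=
    Finset.single_le_sum (f := fun m : ℕ => m) (fun _ _ => Nat.zero_le _) hx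
  have h2 := hs.2
  rw [Finset.mem_range]
  omega

theorem primitiveChains_finite (p q n : ℕ) : (primitiveChains p q n).Finite :=
  (boundedChains_finite p q n).subset fun _ h => h.1

theorem scaleParts_mem_chainFamily {p q : ℕ} {s : Finset ℕ} (hs : s ∈ chainFamily p q) :
    scaleParts p s ∈ chainFamily p q := by
  refine ⟨fun n hn => ?_, ?_⟩
  · obtain ⟨m, hm, rfl⟩ := Finset.mem_image.1 hn
    obtain ⟨a, b, rfl⟩ := hs.1 m hm
    exact ⟨a + 1, b, by ring⟩
  · rintro x hx y hy hxy
    obtain ⟨m, hm, rfl⟩ := Finset.mem_image.1 (Finset.mem_coe.1 hx)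
    obtain ⟨k, hk, rfl⟩ := Finset.mem_image.1 (Finset.mem_coe.1 hy)
    have hmk : m ≠ k := fun h => hxy (by rw [h])
    exact (hs.2 hm hk hmk).imp (mul_dvd_mul_left p) (mul_dvd_mul_left p)

theorem exponent_pos_of_dvd {p q a b : ℕ} (hp : 1 < p) (hpq : p.Coprime q)
    (h : p ∣ p ^ a * q ^ b) : 0 < a := by
  rcases Nat.eq_zero_or_pos a with rfl | ha
  · rw [pow_zero, one_mul] at h
    have := Nat.Coprime.eq_one_of_dvd (hpq.pow_right b) h
    omega
  · exact ha

theorem exists_eq_scaleParts {p q : ℕ} (hp : 1 < p) (hpq : p.Coprime q) {s : Finset ℕ}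
    (hs : s ∈ chainFamily p q) (h : ∀ x ∈ s, p ∣ x) :
    ∃ t ∈ chainFamily p q, scaleParts p t = s := by
  have himg : scaleParts p (s.image (· / p)) = s := by
    ext x
    simp only [scaleParts, Finset.mem_image, exists_exists_and_eq_and]
    constructor
    · rintro ⟨a, ha, rfl⟩
      rwa [Nat.mul_div_cancel' (h a ha)]
    · exact fun hx => ⟨x, hx, Nat.mul_div_cancel' (h x hx)⟩
  refine ⟨s.image (· / p), ⟨fun n hn => ?_, ?_⟩, himg⟩
  · obtain ⟨m, hm, rfl⟩ := Finset.mem_image.1 hn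
    obtain ⟨a, b, rfl⟩ := hs.1 m hm
    have ha := exponent_pos_of_dvd hp hpq (h _ hm)
    refine ⟨a - 1, b, Nat.div_eq_of_eq_mul_right (by omega) ?_⟩
    rw [← mul_assoc, ← pow_succ', Nat.sub_add_cancel ha]
  · rintro x hx y hy hxy
    obtain ⟨m, hm, rfl⟩ := Finset.mem_image.1 (Finset.mem_coe.1 hx)
    obtain ⟨k, hk, rfl⟩ := Finset.mem_image.1 (Finset.mem_coe.1 hy)
    have hmk : m ≠ k := fun h => hxy (by rw [h])
    exact (hs.2 hm hk hmk).imp (Nat.div_dvd_div (h m hm)) (Nat.div_dvd_div (h k hk))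

/-- In a chain without the part `1`, a part prime to `p` forces all parts to be divisible
by `q`. -/
theorem dvd_of_not_dvd {p q : ℕ} {s : Finset ℕ} (hs : s ∈ chainFamily p q) (h1 : 1 ∉ s)
    (h : ∃ x ∈ s, ¬ p ∣ x) : ∀ y ∈ s, q ∣ y := by
  have key : ∀ y ∈ s, ¬ p ∣ y → q ∣ y := by
    intro y hy hpy
    obtain ⟨a, b, rfl⟩ := hs.1 y hy
    have ha : a = 0 := by
      by_contra ha
      exact hpy (Dvd.dvd.mul_right (dvd_pow_self p ha) _)
    have hb : b ≠ 0 := by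
      rintro rfl
      subst ha
      exact h1 (by simpa using hy)
    exact Dvd.dvd.mul_left (dvd_pow_self q hb) _
  obtain ⟨x, hx, hpx⟩ := h
  intro y hy
  by_cases hpy : p ∣ y
  · rcases eq_or_ne x y with rfl | hxy
    · exact key _ hy hpx
    · rcases hs.2 hx hy hxy with h | h
      · exact (key x hx hpx).trans h
      · exact absurd (hpy.trans h) hpx
  · exact key y hy hpy

theorem ncard_all_dvd {p q : ℕ} (hp : 1 < p) (hpq : p.Coprime q) (n : ℕ) :
    {s | s ∈ boundedChains p q n ∧ ∀ x ∈ s, p ∣ x}.ncard = chainCount p q (n / p) := by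
  rw [chainCount, ← Set.ncard_image_of_injective (boundedChains p q (n / p))
    (scaleParts_injective (c := p) (by omega))]
  congr 1
  ext s
  constructor
  · rintro ⟨⟨hs, hsum⟩, h⟩
    obtain ⟨t, ht, rfl⟩ := exists_eq_scaleParts hp hpq hs h
    rw [sum_scaleParts (by omega)] at hsum
    exact ⟨t, ⟨ht, (Nat.le_div_iff_mul_le (by omega)).2 (by rwa [mul_comm])⟩, rfl⟩
  · rintro ⟨t, ⟨ht, hsum⟩, rfl⟩
    refine ⟨⟨scaleParts_mem_chainFamily ht, ?_⟩, fun x hx => ?_⟩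
    · rw [sum_scaleParts (by omega), mul_comm]
      exact (Nat.le_div_iff_mul_le (by omega)).1 hsum
    · obtain ⟨m, -, rfl⟩ := Finset.mem_image.1 hx
      exact dvd_mul_right p m

theorem ncard_primitive_not_one {p q : ℕ} (hq : 1 < q) (hpq : p.Coprime q) (n : ℕ) :
    {s | s ∈ primitiveChains p q n ∧ 1 ∉ s}.ncard = primitiveCount p q (n / q) := by
  rw [primitiveCount, ← Set.ncard_image_of_injective (primitiveChains p q (n / q))
    (scaleParts_injective (c := q) (by omega))]
  congr 1
  ext s
  constructor
  · rintro ⟨⟨⟨hs, hsum⟩, h⟩, h1⟩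
    have hdvd := dvd_of_not_dvd hs h1 h
    rw [chainFamily_comm] at hs
    obtain ⟨t, ht, rfl⟩ := exists_eq_scaleParts hq hpq.symm hs hdvd
    rw [sum_scaleParts (by omega)] at hsum
    rw [chainFamily_comm] at ht
    refine ⟨t, ⟨⟨ht, (Nat.le_div_iff_mul_le (by omega)).2 (by rwa [mul_comm])⟩, ?_⟩, rfl⟩
    obtain ⟨x, hx, hpx⟩ := h
    obtain ⟨m, hm, rfl⟩ := Finset.mem_image.1 hx
    exact ⟨m, hm, fun h => hpx (h.mul_left q)⟩
  · rintro ⟨t, ⟨⟨ht, hsum⟩, x, hx, hpx⟩, rfl⟩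
    rw [chainFamily_comm] at ht
    have hst := scaleParts_mem_chainFamily ht
    rw [chainFamily_comm] at hst
    refine ⟨⟨⟨hst, ?_⟩, q * x, Finset.mem_image_of_mem _ hx, fun h => hpx (hpq.dvd_of_dvd_mul_left h)⟩,
      fun h => ?_⟩
    · rw [sum_scaleParts (by omega), mul_comm]
      exact (Nat.le_div_iff_mul_le (by omega)).1 hsum
    · obtain ⟨m, -, hm⟩ := Finset.mem_image.1 h
      have := Nat.eq_one_of_mul_eq_one_right hm
      omega

/-- The chains outside `primitiveChains` have all parts divisible by p, the empty chain among them;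
dividing by p identifies them with the chains of sum at most n / p. -/
theorem chainCount_eq {p q : ℕ} (hp : 1 < p) (hpq : p.Coprime q) (n : ℕ) :
    chainCount p q n = primitiveCount p q n + chainCount p q (n / p) := by
  rw [← ncard_all_dvd hp hpq n, primitiveCount, chainCount, ← Set.ncard_union_eq ?_
    (primitiveChains_finite p q n)
    ((boundedChains_finite p q n).subset fun _ h => h.1)]
  · congr 1
    ext s
    simp only [primitiveChains, Set.mem_union, Set.mem_ofPred_eq, ← and_or_left]
    refine (and_iff_left ?_).symm
    by_cases h : ∀ x ∈ s, p ∣ x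
    · exact Or.inr h
    · exact Or.inl (by simpa using h)
  · rw [Set.disjoint_left]
    rintro s ⟨-, x, hx, hpx⟩ ⟨-, h⟩
    exact hpx (h x hx)

theorem ncard_not_one {p q : ℕ} (hp : 1 < p) (hq : 1 < q) (hpq : p.Coprime q) (n : ℕ) :
    {s | s ∈ boundedChains p q n ∧ 1 ∉ s}.ncard =
      chainCount p q (n / p) + primitiveCount p q (n / q) := by
  rw [← ncard_all_dvd hp hpq n, ← ncard_primitive_not_one hq hpq n, ← Set.ncard_union_eq ?_
    ((boundedChains_finite p q n).subset fun _ h => h.1)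
    ((primitiveChains_finite p q n).subset fun _ h => h.1)]
  · congr 1
    ext s
    constructor
    · rintro ⟨hs, h1⟩
      by_cases h : ∀ x ∈ s, p ∣ x
      · exact Or.inl ⟨hs, h⟩
      · exact Or.inr ⟨⟨hs, by simpa using h⟩, h1⟩
    · rintro (⟨hs, h⟩ | ⟨⟨hs, -⟩, h1⟩)
      · refine ⟨hs, fun h1 => ?_⟩
        have := Nat.dvd_one.1 (h 1 h1)
        omega
      · exact ⟨hs, h1⟩
  · rw [Set.disjoint_left]
    rintro s ⟨-, h⟩ ⟨⟨-, x, hx, hpx⟩, -⟩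
    exact hpx (h x hx)

/-- Deleting the part 1 lowers the sum by 1. Conversely, 1 divides everything and is not divisible
by p, so inserting it keeps the chain property and makes the chain primitive. -/
theorem ncard_one_mem {p q : ℕ} (hp : 1 < p) {n : ℕ} (hn : 1 ≤ n) :
    {s | s ∈ primitiveChains p q n ∧ 1 ∈ s}.ncard =
      {s | s ∈ boundedChains p q (n - 1) ∧ 1 ∉ s}.ncard := by
  have hinj : Set.InjOn (insert 1) {s : Finset ℕ | s ∈ boundedChains p q (n - 1) ∧ 1 ∉ s} := by
    intro s hs t ht h
    rw [← Finset.erase_insert hs.2, ← Finset.erase_insert ht.2]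
    exact congrArg (Finset.erase · 1) h
  rw [← hinj.ncard_image]
  congr 1
  ext s
  constructor
  · rintro ⟨⟨⟨hs, hsum⟩, -⟩, h1⟩
    refine ⟨s.erase 1, ⟨⟨⟨fun x hx => hs.1 x (Finset.mem_of_mem_erase hx), ?_⟩, ?_⟩,
      Finset.notMem_erase 1 s⟩, Finset.insert_erase h1⟩
    · exact hs.2.mono (Finset.coe_subset.2 (Finset.erase_subset 1 s))
    · have := Finset.add_sum_erase s (fun x => x) h1
      omega
  · rintro ⟨t, ⟨⟨ht, hsum⟩, h1⟩, rfl⟩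
    refine ⟨⟨⟨⟨fun x hx => ?_, ?_⟩, ?_⟩, 1, Finset.mem_insert_self 1 t, fun h => ?_⟩,
      Finset.mem_insert_self 1 t⟩
    · rcases Finset.mem_insert.1 hx with rfl | hx
      · exact ⟨0, 0, by simp⟩
      · exact ht.1 x hx
    · rw [Finset.coe_insert]
      exact ht.2.insert fun b _ _ => Or.inl (one_dvd b)
    · rw [Finset.sum_insert h1]
      omega
    · have := Nat.dvd_one.1 h
      omega

/-- The first two terms count the chains containing 1, the third those without it. -/
theorem primitiveCount_eq {p q : ℕ} (hp : 1 < p) (hq : 1 < q) (hpq : p.Coprime q) {n : ℕ}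
    (hn : 1 ≤ n) :
    primitiveCount p q n =
      chainCount p q ((n - 1) / p) + primitiveCount p q ((n - 1) / q) +
        primitiveCount p q (n / q) := by
  rw [← ncard_not_one hp hq hpq, ← ncard_one_mem hp hn, ← ncard_primitive_not_one hq hpq n,
    primitiveCount, ← Set.ncard_union_eq ?_
    ((primitiveChains_finite p q n).subset fun _ h => h.1)
    ((primitiveChains_finite p q n).subset fun _ h => h.1)]
  · congr 1
    ext s
    simp only [Set.mem_union, Set.mem_ofPred_eq, ← and_or_left, em, and_true]
  · rw [Set.disjoint_left]
    rintro s ⟨-, h⟩ ⟨-, h'⟩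
    exact h' h

theorem boundedChains_zero {p q : ℕ} (hp : 1 < p) (hq : 1 < q) : boundedChains p q 0 = {∅} := by
  ext s
  rw [Set.mem_singleton_iff]
  constructor
  · rintro ⟨hs, hsum⟩
    refine Finset.eq_empty_of_forall_notMem fun x hx => ?_
    have h0 := (Finset.sum_eq_zero_iff.1 (Nat.le_zero.1 hsum)) x hx
    obtain ⟨a, b, rfl⟩ := hs.1 x hx
    have : 0 < p ^ a * q ^ b := by positivity
    omega
  · rintro rfl
    exact ⟨⟨by simp, by simp⟩, by simp⟩

theorem chainCount_zero {p q : ℕ} (hp : 1 < p) (hq : 1 < q) : chainCount p q 0 = 1 := by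
  rw [chainCount, boundedChains_zero hp hq, Set.ncard_singleton]

theorem primitiveCount_zero {p q : ℕ} (hp : 1 < p) (hq : 1 < q) : primitiveCount p q 0 = 0 := by
  rw [primitiveCount, Set.ncard_eq_zero (primitiveChains_finite p q 0),
    Set.eq_empty_iff_forall_notMem]
  rintro s ⟨hs, x, hx, -⟩
  rw [boundedChains_zero hp hq, Set.mem_singleton_iff] at hs
  simp [hs] at hx

theorem chainCount_mono (p q : ℕ) : Monotone (chainCount p q) := fun _ n h =>
  Set.ncard_le_ncard (fun _ hs => ⟨hs.1, hs.2.trans h⟩) (boundedChains_finite p q n)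

theorem primitiveCount_mono (p q : ℕ) : Monotone (primitiveCount p q) := fun _ n h =>
  Set.ncard_le_ncard (fun _ hs => ⟨⟨hs.1.1, hs.1.2.trans h⟩, hs.2⟩) (primitiveChains_finite p q n)

theorem chainCount_succ (p q n : ℕ) :
    chainCount p q (n + 1) = chainCount p q n + chainedCount p q (n + 1) := by
  rw [chainCount, chainCount, chainedCount, ← Set.ncard_union_eq ?_ (boundedChains_finite p q n)
    (chainedPartitions_finite p q (n + 1))]
  · congr 1
    ext s
    simp only [boundedChains, chainedPartitions, IsChainedPartition, Set.mem_union,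
      Set.mem_ofPred_eq, ← and_assoc, chainFamily, ← and_or_left, Nat.le_succ_iff,
      Nat.succ_eq_add_one]
  · rw [Set.disjoint_left]
    rintro s ⟨-, h⟩ ⟨-, -, h'⟩
    omega

/-- The extra 1 is the empty chain, whose sum 0 lies outside the range of summation. -/
theorem chainedSum_add_one {p q : ℕ} (hp : 1 < p) (hq : 1 < q) (x : ℝ) :
    chainedSum p q x + 1 = chainCount p q ⌊x⌋₊ := by
  rw [chainedSum]
  induction ⌊x⌋₊ with
  | zero => simp [chainCount_zero hp hq]
  | succ n ih =>
    rw [Finset.sum_Icc_succ_top (by omega), chainCount_succ, Nat.cast_add, ← ih]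
    ring

/-! ### Density of the numbers p^i q^j on the multiplicative scale -/

/-- Exchanging n copies of b for m copies of a raises a sum by d. From a multiple of b just below X
that contains K n spare copies of b, at most K = ⌈b / d⌉ exchanges are needed to reach X, and the
last one overshoots by at most d. -/
theorem exists_add_mul_near {a b d : ℝ} (hb : 0 < b) {m n : ℕ} (hd : 0 < d)
    (h : m * a - n * b = d) :
    ∃ X₀ : ℝ, ∀ X ≥ X₀, ∃ i j : ℕ, X ≤ i * a + j * b ∧ i * a + j * b ≤ X + d := by
  set K := ⌈b / d⌉₊
  refine ⟨K * (n * b), fun X hX => ?_⟩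
  set l := ⌊(X - K * (n * b)) / b⌋₊
  have hl0 : (0 : ℝ) ≤ (X - K * (n * b)) / b := div_nonneg (by linarith) hb.le
  have hl1 : l * b ≤ X - K * (n * b) := (le_div_iff₀ hb).1 (Nat.floor_le hl0)
  have hl2 : X - K * (n * b) < (l + 1) * b := (div_lt_iff₀ hb).1 (Nat.lt_floor_add_one _)
  set ρ := X - K * (n * b) - l * b
  have hρ0 : 0 ≤ ρ := by simp only [ρ]; linarith
  set k := ⌈ρ / d⌉₊
  have hkK : k ≤ K := Nat.ceil_le_ceil (by gcongr; simp only [ρ]; linarith)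
  have hk1 : ρ ≤ k * d := (div_le_iff₀ hd).1 (Nat.le_ceil _)
  have hk2 : k * d ≤ ρ + d := by
    have := (Nat.ceil_lt_add_one (div_nonneg hρ0 hd.le)).le
    calc k * d ≤ (ρ / d + 1) * d := by gcongr
      _ = ρ + d := by field_simp
  refine ⟨k * m, (K - k) * n + l, ?_⟩
  have hpt : ((k * m : ℕ) : ℝ) * a + (((K - k) * n + l : ℕ) : ℝ) * b
      = K * (n * b) + l * b + k * d := by
    push_cast [Nat.cast_sub hkK]
    rw [← h]
    ring
  rw [hpt]
  simp only [ρ] at hk1 hk2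
  constructor <;> linarith

/-- Irrationality makes the group generated by a and b dense, so it has a positive element m a + n b
below η, a and b. Being below both generators excludes two positive coefficients, so the signs are
opposite and the exchange argument applies. -/
theorem exists_add_mul_mem {a b η : ℝ} (ha : 0 < a) (hb : 0 < b) (hab : Irrational (a / b))
    (hη : 0 < η) :
    ∃ X₀ : ℝ, ∀ X ≥ X₀, ∃ i j : ℕ, X ≤ i * a + j * b ∧ i * a + j * b ≤ X + η := by
  obtain ⟨d, hd, hd0, hdη⟩ := (dense_addSubgroupClosure_pair_iff.2 hab).exists_between
    (lt_min hη (lt_min ha hb))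
  obtain ⟨m, n, hmn⟩ := AddSubgroup.mem_closure_pair.1 hd
  simp only [zsmul_eq_mul] at hmn
  obtain ⟨hdη, hda, hdb⟩ : d < η ∧ d < a ∧ d < b := by simpa [lt_min_iff] using hdη
  rcases le_or_gt m 0 with hm | hm
  · have hn : 0 ≤ n := by
      by_contra! hn
      have h1 : (m : ℝ) ≤ 0 := by exact_mod_cast hm
      have h2 : (n : ℝ) ≤ 0 := by exact_mod_cast hn.le
      nlinarith
    obtain ⟨m', rfl⟩ : ∃ m' : ℕ, m = -m' := ⟨m.natAbs, by omega⟩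
    lift n to ℕ using hn
    push_cast at hmn
    obtain ⟨X₀, hX⟩ := exists_add_mul_near (a := b) ha (m := n) (n := m') hd0 (by linarith)
    refine ⟨X₀, fun X hXX => ?_⟩
    obtain ⟨i, j, h1, h2⟩ := hX X hXX
    exact ⟨j, i, by linarith, by linarith⟩
  · have hn : n ≤ 0 := by
      by_contra! hn
      have h1 : (1 : ℝ) ≤ m := by exact_mod_cast hm
      have h2 : (1 : ℝ) ≤ n := by exact_mod_cast hn
      nlinarith
    obtain ⟨n', rfl⟩ : ∃ n' : ℕ, n = -n' := ⟨n.natAbs, by omega⟩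
    lift m to ℕ using hm.le
    push_cast at hmn
    obtain ⟨X₀, hX⟩ := exists_add_mul_near (a := a) hb (m := m) (n := n') hd0 (by linarith)
    refine ⟨X₀, fun X hXX => ?_⟩
    obtain ⟨i, j, h1, h2⟩ := hX X hXX
    exact ⟨i, j, h1, by linarith⟩

theorem exists_pow_mul_pow_mem {p q c : ℝ} (hp : 1 < p) (hq : 1 < q)
    (hpq : Irrational (Real.log p / Real.log q)) (hc : 1 < c) :
    ∃ X₀ : ℝ, 1 ≤ X₀ ∧ ∀ X ≥ X₀, ∃ i j : ℕ, X ≤ p ^ i * q ^ j ∧ p ^ i * q ^ j ≤ c * X := by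
  obtain ⟨Y, hY⟩ := exists_add_mul_mem (Real.log_pos hp) (Real.log_pos hq) hpq (Real.log_pos hc)
  refine ⟨max 1 (Real.exp Y), le_max_left _ _, fun X hX => ?_⟩
  have hX0 : 0 < X := lt_of_lt_of_le one_pos ((le_max_left _ _).trans hX)
  obtain ⟨i, j, h1, h2⟩ := hY (Real.log X) ((Real.le_log_iff_exp_le hX0).2
    ((le_max_right _ _).trans hX))
  have hpq0 : 0 < p ^ i * q ^ j := by positivity
  have hlog : Real.log (p ^ i * q ^ j) = i * Real.log p + j * Real.log q := by
    rw [Real.log_mul (by positivity) (by positivity), Real.log_pow, Real.log_pow]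
  rw [← hlog] at h1 h2
  refine ⟨i, j, (Real.log_le_log_iff hX0 hpq0).1 h1, (Real.log_le_log_iff hpq0 (by positivity)).1 ?_⟩
  rw [Real.log_mul (by positivity) hX0.ne']
  linarith

/-! ### Renewal inequalities and propagation of bounds -/

/-- A pair of monotone functions with the approximate renewal equations
`T y ≈ 2 T (y / p) + 2 Q (y / q)` and `Q y ≈ T (y / p) + 2 Q (y / q)`, together with the exponent
of their growth. -/
structure RenewalPair (p q α : ℝ) (T Q : ℝ → ℝ) : Prop where
  two_le_left : 2 ≤ p
  two_le_right : 2 ≤ q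
  exponent_pos : 0 < α
  exponent_eq : (1 - p ^ (-α)) * (1 - q ^ (-α)) = 1 / 2
  irrational : Irrational (Real.log p / Real.log q)
  monoT : Monotone T
  monoQ : Monotone Q
  posT : ∀ y, 0 < T y
  nonnegQ : ∀ y, 0 ≤ Q y
  posQ : 0 < Q 1
  T_le : ∀ y, 1 ≤ y → T y ≤ 2 * T (y / p) + 2 * Q (y / q)
  Q_le : ∀ y, 1 ≤ y → Q y ≤ T (y / p) + 2 * Q (y / q)
  le_T : ∀ y, 1 ≤ y → 2 * T ((y - 1) / p) + 2 * Q ((y - 1) / q) ≤ T y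
  le_Q : ∀ y, 1 ≤ y → T ((y - 1) / p) + 2 * Q ((y - 1) / q) ≤ Q y

namespace RenewalPair

variable {p q α : ℝ} {T Q : ℝ → ℝ}

theorem left_pos (h : RenewalPair p q α T Q) : 0 < p := by linarith [h.two_le_left]

theorem right_pos (h : RenewalPair p q α T Q) : 0 < q := by linarith [h.two_le_right]

theorem rpow_left_pos (h : RenewalPair p q α T Q) : 0 < p ^ (-α) := Real.rpow_pos_of_pos h.left_pos _

theorem rpow_left_lt_one (h : RenewalPair p q α T Q) : p ^ (-α) < 1 :=
  Real.rpow_lt_one_of_one_lt_of_neg (by linarith [h.two_le_left]) (by linarith [h.exponent_pos])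

theorem weight_pos (h : RenewalPair p q α T Q) : 0 < 1 - p ^ (-α) := by
  linarith [h.rpow_left_lt_one]

/-- This form of the exponent equation shows that y^α, (1 - p^(-α)) y^α is an exact solution: the
contributions of T and Q to T y are then 2 p^(-α) and 1 - 2 p^(-α). -/
theorem weight_mul (h : RenewalPair p q α T Q) :
    (1 - p ^ (-α)) * q ^ (-α) = 1 / 2 - p ^ (-α) := by
  linarith [h.exponent_eq]

theorem rpow_left_lt_half (h : RenewalPair p q α T Q) : p ^ (-α) < 1 / 2 := by
  have := mul_pos h.weight_pos (Real.rpow_pos_of_pos h.right_pos (-α))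
  linarith [h.weight_mul]

theorem div_rpow_left (h : RenewalPair p q α T Q) {y : ℝ} (hy : 0 ≤ y) :
    (y / p) ^ α = p ^ (-α) * y ^ α := by
  rw [Real.div_rpow hy h.left_pos.le, Real.rpow_neg h.left_pos.le]
  ring

theorem div_rpow_right (h : RenewalPair p q α T Q) {y : ℝ} (hy : 0 ≤ y) :
    (y / q) ^ α = q ^ (-α) * y ^ α := by
  rw [Real.div_rpow hy h.right_pos.le, Real.rpow_neg h.right_pos.le]
  ring

theorem window_le (h : RenewalPair p q α T Q) {N : ℝ} (hN : 1 ≤ N) :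
    p * N ≤ p * q * N ∧ q * N ≤ p * q * N ∧ 4 ≤ p * q * N := by
  have hp := h.two_le_left
  have hq := h.two_le_right
  have h4 : 2 * 2 ≤ p * q := mul_le_mul hp hq (by norm_num) h.left_pos.le
  refine ⟨mul_le_mul_of_nonneg_right ?_ (by linarith), mul_le_mul_of_nonneg_right ?_ (by linarith),
    by nlinarith⟩
  · exact le_mul_of_one_le_right h.left_pos.le (by linarith)
  · exact le_mul_of_one_le_left h.right_pos.le (by linarith)

/-- Beyond the window, y / p and y / q are still at least N and at most y / 2, so induction over
doublings of the range applies, and the exact solution reproduces its own constant. -/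
theorem upper_extend (h : RenewalPair p q α T Q) {A N : ℝ} (hN : 1 ≤ N)
    (hw : ∀ y, N ≤ y → y ≤ p * q * N →
      T y ≤ A * y ^ α ∧ Q y ≤ A * ((1 - p ^ (-α)) * y ^ α)) :
    ∀ y, N ≤ y → T y ≤ A * y ^ α ∧ Q y ≤ A * ((1 - p ^ (-α)) * y ^ α) := by
  have hp := h.two_le_left
  have hq := h.two_le_right
  have key : ∀ k : ℕ, ∀ y, N ≤ y → y ≤ 2 ^ k * (p * q * N) →
      T y ≤ A * y ^ α ∧ Q y ≤ A * ((1 - p ^ (-α)) * y ^ α) := by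
    intro k
    induction k with
    | zero => intro y h1 h2; exact hw y h1 (by simpa using h2)
    | succ k ih =>
      intro y h1 h2
      rcases le_or_gt y (p * q * N) with hy | hy
      · exact hw y h1 hy
      · have hy0 : 0 ≤ y := by linarith
        have hp1 : N ≤ y / p := (le_div_iff₀ h.left_pos).2 (by nlinarith)
        have hq1 : N ≤ y / q := (le_div_iff₀ h.right_pos).2 (by nlinarith)
        have hy2 : y / 2 ≤ 2 ^ k * (p * q * N) := by rw [pow_succ] at h2; linarith
        have hp2 : y / p ≤ y / 2 := div_le_div_of_nonneg_left hy0 two_pos hp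
        have hq2 : y / q ≤ y / 2 := div_le_div_of_nonneg_left hy0 two_pos hq
        have a1 := (ih (y / p) hp1 (hp2.trans hy2)).1
        have a2 := (ih (y / q) hq1 (hq2.trans hy2)).2
        rw [h.div_rpow_left hy0] at a1
        rw [h.div_rpow_right hy0, ← mul_assoc (1 - p ^ (-α)), h.weight_mul] at a2
        have b1 := h.T_le y (by linarith)
        have b2 := h.Q_le y (by linarith)
        constructor <;> nlinarith
  intro y hy
  obtain ⟨k, hk⟩ := pow_unbounded_of_one_lt (y / (p * q * N)) (one_lt_two : (1 : ℝ) < 2)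
  refine key k y hy ?_
  have : 0 < p * q * N := by have := h.left_pos; have := h.right_pos; positivity
  exact ((div_lt_iff₀ this).1 hk).le

/-- The comparison function uses y + 1 to absorb the shift: (y - 1) / p + 1 ≥ (y + 1) / p because p
≥ 2, and likewise for q. -/
theorem lower_extend (h : RenewalPair p q α T Q) {B N : ℝ} (hB : 0 ≤ B) (hN : 1 ≤ N)
    (hw : ∀ y, N ≤ y → y ≤ 2 * (p * q) * N →
      B * (y + 1) ^ α ≤ T y ∧ B * ((1 - p ^ (-α)) * (y + 1) ^ α) ≤ Q y) :
    ∀ y, N ≤ y → B * (y + 1) ^ α ≤ T y ∧ B * ((1 - p ^ (-α)) * (y + 1) ^ α) ≤ Q y := by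
  have hp := h.two_le_left
  have hq := h.two_le_right
  have hw0 := h.weight_pos
  have key : ∀ k : ℕ, ∀ y, N ≤ y → y ≤ 2 ^ k * (2 * (p * q) * N) →
      B * (y + 1) ^ α ≤ T y ∧ B * ((1 - p ^ (-α)) * (y + 1) ^ α) ≤ Q y := by
    intro k
    induction k with
    | zero => intro y h1 h2; exact hw y h1 (by simpa using h2)
    | succ k ih =>
      intro y h1 h2
      rcases le_or_gt y (2 * (p * q) * N) with hy | hy
      · exact hw y h1 hy
      · have hy0 : 0 ≤ y := by linarith
        have hpq := h.window_le hN
        have hp1 : N ≤ (y - 1) / p := (le_div_iff₀ h.left_pos).2 (by nlinarith)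
        have hq1 : N ≤ (y - 1) / q := (le_div_iff₀ h.right_pos).2 (by nlinarith)
        have hy2 : y / 2 ≤ 2 ^ k * (2 * (p * q) * N) := by rw [pow_succ] at h2; linarith
        have hp2 : (y - 1) / p ≤ y / 2 := by
          rw [div_le_div_iff₀ h.left_pos two_pos]; nlinarith
        have hq2 : (y - 1) / q ≤ y / 2 := by
          rw [div_le_div_iff₀ h.right_pos two_pos]; nlinarith
        have a1 := (ih ((y - 1) / p) hp1 (hp2.trans hy2)).1
        have a2 := (ih ((y - 1) / q) hq1 (hq2.trans hy2)).2
        have c1 : ((y + 1) / p) ^ α ≤ ((y - 1) / p + 1) ^ α := by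
          refine Real.rpow_le_rpow (div_nonneg (by linarith) h.left_pos.le) ?_ h.exponent_pos.le
          rw [div_add_one h.left_pos.ne']
          exact div_le_div_of_nonneg_right (by linarith) h.left_pos.le
        have c2 : ((y + 1) / q) ^ α ≤ ((y - 1) / q + 1) ^ α := by
          refine Real.rpow_le_rpow (div_nonneg (by linarith) h.right_pos.le) ?_ h.exponent_pos.le
          rw [div_add_one h.right_pos.ne']
          exact div_le_div_of_nonneg_right (by linarith) h.right_pos.le
        have d1 := (mul_le_mul_of_nonneg_left c1 hB).trans a1
        have d2 := (mul_le_mul_of_nonneg_left (mul_le_mul_of_nonneg_left c2 hw0.le) hB).trans a2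
        rw [h.div_rpow_left (by linarith)] at d1
        rw [h.div_rpow_right (by linarith), ← mul_assoc (1 - p ^ (-α)), h.weight_mul] at d2
        have b1 := h.le_T y (by linarith)
        have b2 := h.le_Q y (by linarith)
        constructor <;> nlinarith
  intro y hy
  obtain ⟨k, hk⟩ := pow_unbounded_of_one_lt (y / (2 * (p * q) * N)) (one_lt_two : (1 : ℝ) < 2)
  refine key k y hy ?_
  have : 0 < 2 * (p * q) * N := by have := h.left_pos; have := h.right_pos; positivity
  exact ((div_lt_iff₀ this).1 hk).le

/-- One of the two functions is nearly as large at `y` as the constant `C` predicts. -/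
def NearTop (p α : ℝ) (T Q : ℝ → ℝ) (C δ y : ℝ) : Prop :=
  (C - δ) * y ^ α ≤ T y ∨ (C - δ) * ((1 - p ^ (-α)) * y ^ α) ≤ Q y

/-- T y and Q y are both bounded by positive combinations of T (y / p) and Q (y / q). If either
combination nearly attains its maximum while each summand is below its own bound, then both summands
are nearly maximal. The factor K pays for division by the coefficients; 3 suffices in all four
cases. -/
theorem nearTop_step (h : RenewalPair p q α T Q) {C δ N K y : ℝ} (hδ : 0 ≤ δ)
    (hK1 : 3 ≤ K * p ^ (-α)) (hK2 : 3 ≤ K * (1 - 2 * p ^ (-α)))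
    (hup : ∀ y, N ≤ y → T y ≤ (C + δ) * y ^ α ∧ Q y ≤ (C + δ) * ((1 - p ^ (-α)) * y ^ α))
    (hy : 1 ≤ y) (hyp : N ≤ y / p) (hyq : N ≤ y / q) (hn : NearTop p α T Q C δ y) :
    (C - K * δ) * (y / p) ^ α ≤ T (y / p) ∧
      (C - K * δ) * ((1 - p ^ (-α)) * (y / q) ^ α) ≤ Q (y / q) := by
  have hy0 : 0 ≤ y := by linarith
  have a1 := (hup _ hyp).1
  have a2 := (hup _ hyq).2
  have e1 := h.div_rpow_left hy0
  have e2 := h.div_rpow_right hy0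
  have hP := h.rpow_left_pos
  have hP2 := h.rpow_left_lt_half
  have hR : 0 ≤ y ^ α := Real.rpow_nonneg hy0 _
  have hδR : 0 ≤ δ * y ^ α := mul_nonneg hδ hR
  rw [e2, ← mul_assoc (1 - p ^ (-α)), h.weight_mul] at a2 ⊢
  rw [e1] at a1 ⊢
  have b1 := h.T_le y hy
  have b2 := h.Q_le y hy
  have k1 := mul_le_mul_of_nonneg_right hK1 hδR
  have k2 := mul_le_mul_of_nonneg_right hK2 hδR
  have k3 := mul_nonneg hP.le hδR
  rcases hn with hn | hn <;> constructor <;> nlinarith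

/-- A division by p yields the T alternative of `NearTop` and a division by q the Q alternative.
Either one is enough to continue, so divisions can follow in any order, each costing a factor K. -/
theorem nearTop_iterate (h : RenewalPair p q α T Q) {C δ N K y : ℝ} (hδ : 0 ≤ δ) (hK : 1 ≤ K)
    (hN : 1 ≤ N)
    (hK1 : 3 ≤ K * p ^ (-α)) (hK2 : 3 ≤ K * (1 - 2 * p ^ (-α)))
    (hup : ∀ y, N ≤ y → T y ≤ (C + δ) * y ^ α ∧ Q y ≤ (C + δ) * ((1 - p ^ (-α)) * y ^ α))
    (hn : NearTop p α T Q C δ y) (i j : ℕ) (hy : p * q * N ≤ y / (p ^ i * q ^ j)) :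
    NearTop p α T Q C (K ^ (i + j) * δ) (y / (p ^ i * q ^ j)) := by
  have hp := h.two_le_left
  have hq := h.two_le_right
  have hup' : ∀ k : ℕ, ∀ y, N ≤ y → T y ≤ (C + K ^ k * δ) * y ^ α ∧
      Q y ≤ (C + K ^ k * δ) * ((1 - p ^ (-α)) * y ^ α) := by
    intro k y hy
    have hδk : δ ≤ K ^ k * δ := le_mul_of_one_le_left hδ (one_le_pow₀ hK)
    have hR : 0 ≤ y ^ α := Real.rpow_nonneg (by linarith) _
    have hw := h.weight_pos
    exact ⟨(hup y hy).1.trans (by gcongr), (hup y hy).2.trans (by gcongr)⟩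
  have hstep : ∀ k : ℕ, ∀ z, p * q * N ≤ z → NearTop p α T Q C (K ^ k * δ) z →
      (C - K ^ (k + 1) * δ) * (z / p) ^ α ≤ T (z / p) ∧
        (C - K ^ (k + 1) * δ) * ((1 - p ^ (-α)) * (z / q) ^ α) ≤ Q (z / q) := by
    intro k z hz hzn
    have hpq := h.window_le hN
    have := h.nearTop_step (K := K) (by positivity) hK1 hK2 (hup' k) (y := z) (by linarith)
      ((le_div_iff₀ h.left_pos).2 (by linarith)) ((le_div_iff₀ h.right_pos).2 (by linarith)) hzn
    rwa [← mul_assoc, ← pow_succ'] at this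
  induction i with
  | zero =>
    induction j with
    | zero => simpa using hn
    | succ j ih =>
      have e : y / (p ^ 0 * q ^ (j + 1)) = y / (p ^ 0 * q ^ j) / q := by
        rw [div_div, pow_succ]; ring_nf
      rw [e] at hy ⊢
      have hy' : p * q * N ≤ y / (p ^ 0 * q ^ j) := by
        have := (le_div_iff₀ h.right_pos).1 hy
        nlinarith [h.window_le hN]
      exact Or.inr (hstep _ _ hy' (ih hy')).2
  | succ i ih =>
    have e : y / (p ^ (i + 1) * q ^ j) = y / (p ^ i * q ^ j) / p := by
      rw [div_div, pow_succ]; ring_nf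
    rw [e] at hy ⊢
    have hy' : p * q * N ≤ y / (p ^ i * q ^ j) := by
      have := (le_div_iff₀ h.left_pos).1 hy
      nlinarith [h.window_le hN]
    have := Or.inl (b := (C - K ^ (i + 1 + j) * δ) *
      ((1 - p ^ (-α)) * (y / (p ^ i * q ^ j) / p) ^ α) ≤ Q (y / (p ^ i * q ^ j) / p))
      (hstep _ _ hy' (ih hy')).1
    rw [show i + j + 1 = i + 1 + j by ring] at this
    exact this

end RenewalPair

/-! ### Existence of the asymptotic constant -/

namespace RenewalPair

variable {p q α : ℝ} {T Q : ℝ → ℝ}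

theorem exists_gain (h : RenewalPair p q α T Q) :
    ∃ K : ℝ, 1 ≤ K ∧ 3 ≤ K * p ^ (-α) ∧ 3 ≤ K * (1 - 2 * p ^ (-α)) := by
  have hP := h.rpow_left_pos
  have hP2 := h.rpow_left_lt_half
  have hD : 0 < 1 - 2 * p ^ (-α) := by linarith
  refine ⟨3 / (p ^ (-α) * (1 - 2 * p ^ (-α))), ?_, ?_, ?_⟩
  · rw [le_div_iff₀ (by positivity)]
    nlinarith
  · rw [div_mul_eq_mul_div, le_div_iff₀ (by positivity)]
    nlinarith
  · rw [div_mul_eq_mul_div, le_div_iff₀ (by positivity)]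
    nlinarith

/-- If the functions come arbitrarily close to their asymptotic upper bound, then they are close
to it on a whole window. -/
theorem exists_window_of_nearTop (h : RenewalPair p q α T Q) {B C : ℝ} (hB : 0 < B) (hBC : B < C)
    (hup : ∀ A, C < A → ∃ N : ℝ, 1 ≤ N ∧
      ∀ y, N ≤ y → T y ≤ A * y ^ α ∧ Q y ≤ A * ((1 - p ^ (-α)) * y ^ α))
    (hnear : ∀ δ, 0 < δ → ∀ Y : ℝ, ∃ y, Y ≤ y ∧ NearTop p α T Q C δ y) :
    ∃ N : ℝ, 1 ≤ N ∧ ∀ y, N ≤ y → y ≤ 2 * (p * q) * N →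
      B * (y + 1) ^ α ≤ T y ∧ B * ((1 - p ^ (-α)) * (y + 1) ^ α) ≤ Q y := by
  have hp := h.two_le_left
  have hq := h.two_le_right
  have hp0 := h.left_pos
  have hq0 := h.right_pos
  have hα := h.exponent_pos
  have hw := h.weight_pos
  obtain ⟨K, hK, hK1, hK2⟩ := h.exists_gain
  obtain ⟨B', hBB', hB'C⟩ := exists_between hBC
  -- The loss from B' to B is c ^ (2 α): one factor c replaces x + 1 by x, the other covers the gap
  -- between x and a point y / (p ^ i * q ^ j) below it.
  set c : ℝ := (B' / B) ^ (1 / (2 * α))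
  have hc : 1 < c := Real.one_lt_rpow ((one_lt_div hB).2 hBB') (by positivity)
  have hc0 : 0 < c := by linarith
  have hcα : B' = B * (c ^ α * c ^ α) := by
    rw [← Real.rpow_add hc0, ← Real.rpow_mul (div_pos (hB.trans hBB') hB).le,
      show 1 / (2 * α) * (α + α) = 1 by field_simp; ring, Real.rpow_one]
    field_simp
  obtain ⟨X₀, hX₀, hdense⟩ := exists_pow_mul_pow_mem (by linarith) (by linarith) h.irrational hc
  obtain ⟨hw1, hw2, hw3⟩ := h.window_le hX₀
  set X₁ := p * q * X₀
  set r := 2 * (p * q)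
  have hr : 1 ≤ r := by simp only [r]; nlinarith
  -- L bounds the number i + j of divisions used anywhere on the window, since 2 ^ (i + j) ≤ p ^ i *
  -- q ^ j. Then δ is small enough for the accumulated loss K ^ L * δ to equal C - B'.
  obtain ⟨L, hL⟩ := pow_unbounded_of_one_lt (c * (r * X₁)) (one_lt_two : (1 : ℝ) < 2)
  set δ := (C - B') / K ^ L
  have hδ : 0 < δ := div_pos (by linarith) (by positivity)
  have hKδ : K ^ L * δ = C - B' := by simp only [δ]; field_simp
  obtain ⟨N₀, hN₀, hupN⟩ := hup (C + δ) (by linarith)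
  -- For x in the window starting at y / (r X₁), the quotient y / x runs through [X₁, r X₁]. The
  -- size of y makes x ≥ 1 / (c - 1), so that x + 1 ≤ c x, and keeps the divided points above p q
  -- N₀.
  obtain ⟨y, hy, hny⟩ := hnear δ hδ (r * X₁ * (1 + 1 / (c - 1) + c * (p * q * N₀)))
  have hrX : 0 < r * X₁ := by positivity
  have hc1 : 0 < 1 / (c - 1) := by have := sub_pos.2 hc; positivity
  have hcN : 0 < c * (p * q * N₀) := by positivity
  have hN : 1 + 1 / (c - 1) + c * (p * q * N₀) ≤ y / (r * X₁) :=
    (le_div_iff₀ hrX).2 (by linarith)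
  have hy0 : 0 < y := lt_of_lt_of_le (by positivity) hy
  refine ⟨y / (r * X₁), by linarith, fun x hx1 hx2 => ?_⟩
  have hx0 : 0 < x := by linarith
  have hX : X₁ ≤ y / x := by
    rw [le_div_iff₀ hx0]
    calc X₁ * x ≤ X₁ * (r * (y / (r * X₁))) := by gcongr
      _ = y := by field_simp
  have hX' : y / x ≤ r * X₁ := by
    rw [div_le_iff₀ hx0]
    rw [div_le_iff₀ hrX] at hx1
    linarith
  have key : ∀ i j : ℕ, y / x ≤ p ^ i * q ^ j → p ^ i * q ^ j ≤ c * (y / x) →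
      (i + j ≤ L) ∧ y / (p ^ i * q ^ j) ≤ x ∧ x ≤ c * (y / (p ^ i * q ^ j)) ∧
      p * q * N₀ ≤ y / (p ^ i * q ^ j) := by
    intro i j h1 h2
    have hm0 : 0 < p ^ i * q ^ j := by positivity
    have h3 : x ≤ c * (y / (p ^ i * q ^ j)) := by
      rw [← mul_div_assoc, le_div_iff₀ hm0]
      rw [← mul_div_assoc, le_div_iff₀ hx0] at h2
      linarith
    refine ⟨?_, ?_, h3, ?_⟩
    · have h4 : (2 : ℝ) ^ (i + j) < 2 ^ L := by
        calc (2 : ℝ) ^ (i + j) = 2 ^ i * 2 ^ j := pow_add _ _ _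
          _ ≤ p ^ i * q ^ j := by gcongr
          _ ≤ c * (y / x) := h2
          _ ≤ c * (r * X₁) := by gcongr
          _ < 2 ^ L := hL
      exact ((pow_lt_pow_iff_right₀ one_lt_two).1 h4).le
    · rw [div_le_iff₀ hm0]
      rw [div_le_iff₀ hx0] at h1
      linarith
    · have : c * (p * q * N₀) ≤ c * (y / (p ^ i * q ^ j)) := by linarith
      exact le_of_mul_le_mul_left this hc0
  have hbase : ∀ z, 0 < z → x ≤ c * z → B * (x + 1) ^ α ≤ B' * z ^ α := by
    intro z hz hxz
    have h1 : x + 1 ≤ c * x := by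
      have : 1 / (c - 1) ≤ x := by linarith
      rw [div_le_iff₀ (sub_pos.2 hc)] at this
      linarith
    calc B * (x + 1) ^ α ≤ B * (c * (c * z)) ^ α := by
          gcongr
          exact h1.trans (by gcongr)
      _ = B' * z ^ α := by
          rw [Real.mul_rpow hc0.le (by positivity), Real.mul_rpow hc0.le hz.le, hcα]
          ring
  have hδk : ∀ k ≤ L, B' ≤ C - K ^ k * δ := by
    intro k hk
    have : K ^ k * δ ≤ K ^ L * δ := by gcongr
    linarith
  have hpq := h.window_le hN₀
  have hNN : N₀ ≤ p * q * N₀ := by nlinarith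
  have hmul : ∀ s z : ℝ, 2 ≤ s → p * q * N₀ ≤ z / s → p * q * N₀ ≤ z := by
    intro s z hs hz
    have := (le_div_iff₀ (by linarith)).1 hz
    nlinarith
  have hstep : ∀ i j : ℕ, i + j + 1 ≤ L → N₀ ≤ y / (p ^ i * q ^ j) / p → N₀ ≤ y / (p ^ i * q ^ j) / q →
      p * q * N₀ ≤ y / (p ^ i * q ^ j) →
      B' * (y / (p ^ i * q ^ j) / p) ^ α ≤ T (y / (p ^ i * q ^ j) / p) ∧
      B' * ((1 - p ^ (-α)) * (y / (p ^ i * q ^ j) / q) ^ α) ≤ Q (y / (p ^ i * q ^ j) / q) := by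
    intro i j hij h1 h2 h3
    have hn := h.nearTop_iterate hδ.le hK hN₀ hK1 hK2 hupN hny i j h3
    have hδij : δ ≤ K ^ (i + j) * δ := le_mul_of_one_le_left hδ.le (one_le_pow₀ hK)
    have hup' : ∀ z, N₀ ≤ z → T z ≤ (C + K ^ (i + j) * δ) * z ^ α ∧
        Q z ≤ (C + K ^ (i + j) * δ) * ((1 - p ^ (-α)) * z ^ α) := by
      intro z hz
      have hR : 0 ≤ z ^ α := Real.rpow_nonneg (by linarith) _
      exact ⟨(hupN z hz).1.trans (by gcongr), (hupN z hz).2.trans (by gcongr)⟩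
    have := h.nearTop_step (by positivity) hK1 hK2 hup' (by linarith) h1 h2 hn
    rw [← mul_assoc, ← pow_succ'] at this
    have hB' := hδk _ hij
    have hz0 : 0 < y / (p ^ i * q ^ j) := by positivity
    constructor
    · refine le_trans ?_ this.1
      gcongr
    · refine le_trans ?_ this.2
      gcongr
  constructor
  -- The last division has to be by p, since it is the one that controls T; density is therefore
  -- used at y / x / p, which is still at least X₀. For Q the last division is by q.
  · obtain ⟨i, j, h1, h2⟩ := hdense (y / x / p) ((le_div_iff₀ hp0).2 (by linarith))
    obtain ⟨k1, k2, k3, k4⟩ := key (i + 1) j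
      (by rw [div_le_iff₀ hp0] at h1; rw [pow_succ]; linarith)
      (by rw [← mul_div_assoc, le_div_iff₀ hp0] at h2; rw [pow_succ]; linarith)
    have e : y / (p ^ (i + 1) * q ^ j) = y / (p ^ i * q ^ j) / p := by
      rw [div_div, pow_succ]; ring_nf
    rw [e] at k2 k3 k4
    have hz' := hmul p _ hp k4
    refine (hbase _ (by linarith) k3).trans (((hstep i j (by omega) (by linarith)
      ((le_div_iff₀ hq0).2 (by linarith)) hz').1).trans (h.monoT k2))
  · obtain ⟨i, j, h1, h2⟩ := hdense (y / x / q) ((le_div_iff₀ hq0).2 (by linarith))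
    obtain ⟨k1, k2, k3, k4⟩ := key i (j + 1)
      (by rw [div_le_iff₀ hq0] at h1; rw [pow_succ]; linarith)
      (by rw [← mul_div_assoc, le_div_iff₀ hq0] at h2; rw [pow_succ]; linarith)
    have e : y / (p ^ i * q ^ (j + 1)) = y / (p ^ i * q ^ j) / q := by
      rw [div_div, pow_succ]; ring_nf
    rw [e] at k2 k3 k4
    have hz' := hmul q _ hq k4
    refine le_trans ?_ (((hstep i j (by omega)
      ((le_div_iff₀ hp0).2 (by linarith)) (by linarith) hz').2).trans (h.monoQ k2))
    have := mul_le_mul_of_nonneg_left (hbase _ (by linarith) k3) hw.le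
    linarith

/-- An eventual upper bound of both functions. -/
def IsEventualUpper (p α : ℝ) (T Q : ℝ → ℝ) (A : ℝ) : Prop :=
  ∃ N : ℝ, 1 ≤ N ∧ ∀ y, N ≤ y → T y ≤ A * y ^ α ∧ Q y ≤ A * ((1 - p ^ (-α)) * y ^ α)

/-- An eventual lower bound of both functions. -/
def IsEventualLower (p α : ℝ) (T Q : ℝ → ℝ) (B : ℝ) : Prop :=
  ∃ N : ℝ, 1 ≤ N ∧ ∀ y, N ≤ y →
    B * (y + 1) ^ α ≤ T y ∧ B * ((1 - p ^ (-α)) * (y + 1) ^ α) ≤ Q y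

theorem le_of_isEventual (h : RenewalPair p q α T Q) {A B : ℝ} (hA : IsEventualUpper p α T Q A)
    (hB : IsEventualLower p α T Q B) : B ≤ A := by
  obtain ⟨N, hN, hA⟩ := hA
  obtain ⟨M, hM, hB⟩ := hB
  have h1 := (hA (max N M) (le_max_left _ _)).1
  have h2 := (hB (max N M) (le_max_right _ _)).1
  have h0 : 0 < max N M := lt_of_lt_of_le (by linarith) (le_max_left _ _)
  have h3 : (max N M) ^ α ≤ (max N M + 1) ^ α :=
    Real.rpow_le_rpow h0.le (by linarith) h.exponent_pos.le
  have h4 : 0 < (max N M) ^ α := Real.rpow_pos_of_pos h0 _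
  by_contra! hAB
  have hA0 : 0 < A := by
    have := h.posT (max N M)
    by_contra! hA0
    nlinarith
  nlinarith

theorem IsEventualUpper.mono (h : RenewalPair p q α T Q) {A A' : ℝ} (hAA : A ≤ A')
    (hA : IsEventualUpper p α T Q A) : IsEventualUpper p α T Q A' := by
  obtain ⟨N, hN, hA⟩ := hA
  refine ⟨N, hN, fun y hy => ?_⟩
  have hR : 0 ≤ y ^ α := Real.rpow_nonneg (by linarith) _
  have hw := h.weight_pos
  exact ⟨(hA y hy).1.trans (by gcongr), (hA y hy).2.trans (by gcongr)⟩

theorem exists_isEventualUpper (h : RenewalPair p q α T Q) : ∃ A, IsEventualUpper p α T Q A := by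
  have hw := h.weight_pos
  refine ⟨T (p * q) + Q (p * q) / (1 - p ^ (-α)), 1, le_rfl, h.upper_extend le_rfl ?_⟩
  intro y h1 h2
  rw [mul_one] at h2
  have hR : 1 ≤ y ^ α := Real.one_le_rpow h1 h.exponent_pos.le
  have hT := h.monoT h2
  have hQ := h.monoQ h2
  have hT0 := h.posT (p * q)
  have hQ0 := h.nonnegQ (p * q)
  have hQw : 0 ≤ Q (p * q) / (1 - p ^ (-α)) := div_nonneg hQ0 hw.le
  constructor
  · nlinarith
  · have : (T (p * q) + Q (p * q) / (1 - p ^ (-α))) * ((1 - p ^ (-α)) * y ^ α) =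
        (T (p * q) * (1 - p ^ (-α)) + Q (p * q)) * y ^ α := by field_simp
    rw [this]
    nlinarith [mul_pos hT0 hw]

theorem exists_isEventualLower (h : RenewalPair p q α T Q) :
    ∃ B, 0 < B ∧ IsEventualLower p α T Q B := by
  have hw := h.weight_pos
  have hR : 0 < (2 * (p * q) + 1) ^ α :=
    Real.rpow_pos_of_pos (by have := h.left_pos; have := h.right_pos; positivity) _
  have hQ1 := h.posQ
  have hT1 := h.posT 1
  set m := min (T 1) (Q 1)
  have hm : 0 < m := lt_min hT1 hQ1
  have hB : 0 < m / (2 * (p * q) + 1) ^ α := by positivity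
  refine ⟨m / (2 * (p * q) + 1) ^ α, hB, 1, le_rfl, h.lower_extend hB.le le_rfl ?_⟩
  intro y h1 h2
  rw [mul_one] at h2
  have h3 : (y + 1) ^ α ≤ (2 * (p * q) + 1) ^ α :=
    Real.rpow_le_rpow (by linarith) (by linarith) h.exponent_pos.le
  have h4 : m / (2 * (p * q) + 1) ^ α * (y + 1) ^ α ≤ m := by
    rw [div_mul_eq_mul_div, div_le_iff₀ hR]
    gcongr
  have h5 : 0 ≤ m / (2 * (p * q) + 1) ^ α * (y + 1) ^ α :=
    mul_nonneg hB.le (Real.rpow_nonneg (by linarith) _)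
  refine ⟨h4.trans ((min_le_left (T 1) (Q 1)).trans (h.monoT h1)),
    le_trans ?_ ((min_le_right (T 1) (Q 1)).trans (h.monoQ h1))⟩
  have h6 := h.rpow_left_pos
  nlinarith

/-- C is the infimum of the eventual upper constants. If `NearTop` failed for some δ at all large y,
then C - δ would be an eventual upper constant; hence near-equality recurs at arbitrarily large y,
and the window it yields extends to infinity. -/
theorem exists_limit (h : RenewalPair p q α T Q) :
    ∃ C, 0 < C ∧ (∀ A, C < A → IsEventualUpper p α T Q A) ∧
      ∀ B, 0 < B → B < C → IsEventualLower p α T Q B := by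
  obtain ⟨A₀, hA₀⟩ := h.exists_isEventualUpper
  obtain ⟨B₀, hB₀, hBl⟩ := h.exists_isEventualLower
  have hbdd : BddBelow {A | IsEventualUpper p α T Q A} := ⟨B₀, fun A hA => h.le_of_isEventual hA hBl⟩
  set C := sInf {A | IsEventualUpper p α T Q A}
  have hC : 0 < C := hB₀.trans_le (le_csInf ⟨A₀, hA₀⟩ fun A hA => h.le_of_isEventual hA hBl)
  have hup : ∀ A, C < A → IsEventualUpper p α T Q A := by
    intro A hA
    obtain ⟨A', hA', hlt⟩ := (csInf_lt_iff hbdd ⟨A₀, hA₀⟩).1 hA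
    exact IsEventualUpper.mono h hlt.le hA'
  refine ⟨C, hC, hup, fun B hB hBC => ?_⟩
  have hnear : ∀ δ, 0 < δ → ∀ Y : ℝ, ∃ y, Y ≤ y ∧ NearTop p α T Q C δ y := by
    intro δ hδ Y
    by_contra! hcon
    have : IsEventualUpper p α T Q (C - δ) := by
      refine ⟨max 1 Y, le_max_left _ _, fun y hy => ?_⟩
      have := hcon y ((le_max_right _ _).trans hy)
      simp only [NearTop, not_or, not_le] at this
      exact ⟨this.1.le, this.2.le⟩
    have := csInf_le hbdd this
    linarith
  obtain ⟨N, hN, hwin⟩ := h.exists_window_of_nearTop hB hBC hup hnear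
  exact ⟨N, hN, h.lower_extend hB.le hN hwin⟩

end RenewalPair

/-! ### The integral bound for the constant -/

namespace RenewalPair

variable {p q α : ℝ} {T Q : ℝ → ℝ}

/-- A function in the logarithmic scale, normalized by the growth `y ^ α`. -/
noncomputable def logScale (α : ℝ) (f : ℝ → ℝ) (u : ℝ) : ℝ := f (Real.exp u) * Real.exp (-α * u)

theorem intervalIntegrable_logScale (α : ℝ) {f : ℝ → ℝ} (hf : Monotone f) (a b : ℝ) :
    IntervalIntegrable (logScale α f) MeasureTheory.volume a b :=
  (hf.comp Real.exp_monotone).intervalIntegrable.mul_continuousOn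
    (Continuous.continuousOn (by fun_prop))

theorem exp_rpow_mul_exp (α u : ℝ) : Real.exp u ^ α * Real.exp (-α * u) = 1 := by
  rw [← Real.exp_mul, ← Real.exp_add, Real.exp_eq_one_iff]
  ring

theorem exp_sub_log {c : ℝ} (hc : 0 < c) (u : ℝ) : Real.exp (u - Real.log c) = Real.exp u / c := by
  rw [Real.exp_sub, Real.exp_log hc]

theorem logScale_sub_log {c : ℝ} (hc : 0 < c) (α u : ℝ) (f : ℝ → ℝ) :
    c ^ (-α) * logScale α f (u - Real.log c) = f (Real.exp u / c) * Real.exp (-α * u) := by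
  rw [logScale, exp_sub_log hc, mul_sub, sub_eq_add_neg, Real.exp_add, Real.rpow_def_of_pos hc,
    show -(-α * Real.log c) = -(Real.log c * -α) by ring, Real.exp_neg]
  have := Real.exp_pos (Real.log c * -α)
  field_simp

/-- The weights p^(-α) and 1 - 2 p^(-α) form a left eigenvector, with eigenvalue 1, of the
coefficient matrix of the normalized system, so the weighted sum of the two inequalities reproduces
the same weights on the right. -/
theorem logScale_step (h : RenewalPair p q α T Q) {u : ℝ} (hu : 0 ≤ u) :
    p ^ (-α) * logScale α T u + (1 - 2 * p ^ (-α)) * logScale α Q u ≤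
      p ^ (-α) * logScale α T (u - Real.log p) +
        (1 - 2 * p ^ (-α)) * logScale α Q (u - Real.log q) := by
  have hy : 1 ≤ Real.exp u := Real.one_le_exp hu
  have e := Real.exp_pos (-α * u)
  have b1 := mul_le_mul_of_nonneg_right (h.T_le _ hy) e.le
  have b2 := mul_le_mul_of_nonneg_right (h.Q_le _ hy) e.le
  rw [add_mul, mul_assoc, mul_assoc, ← logScale_sub_log h.left_pos, ← logScale_sub_log h.right_pos]
    at b1
  rw [add_mul, mul_assoc, ← logScale_sub_log h.left_pos, ← logScale_sub_log h.right_pos] at b2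
  have hP := h.rpow_left_pos
  have hP2 := h.rpow_left_lt_half
  have hS := h.weight_mul
  change logScale α T u ≤ _ at b1
  change logScale α Q u ≤ _ at b2
  have c1 := mul_le_mul_of_nonneg_left b1 hP.le
  have c2 := mul_le_mul_of_nonneg_left b2 (by linarith : 0 ≤ 1 - 2 * p ^ (-α))
  have c3 : (1 - p ^ (-α)) * q ^ (-α) * logScale α Q (u - Real.log q) =
      (1 / 2 - p ^ (-α)) * logScale α Q (u - Real.log q) := by rw [hS]
  linarith

/-- After integration of `logScale_step` over [0, u], the shifted and unshifted integrals cancel on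
their overlap and only the two end windows remain. -/
theorem logScale_integral_le (h : RenewalPair p q α T Q) {u : ℝ} (hu : 0 ≤ u) :
    p ^ (-α) * (∫ x in (u - Real.log p)..u, logScale α T x) +
        (1 - 2 * p ^ (-α)) * (∫ x in (u - Real.log q)..u, logScale α Q x) ≤
      p ^ (-α) * (∫ x in (0 - Real.log p)..0, logScale α T x) +
        (1 - 2 * p ^ (-α)) * (∫ x in (0 - Real.log q)..0, logScale α Q x) := by
  have iT := intervalIntegrable_logScale α h.monoT
  have iQ := intervalIntegrable_logScale α h.monoQ
  have iT' : IntervalIntegrable (fun x => logScale α T (x - Real.log p)) MeasureTheory.volume 0 u := by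
    simpa using (iT (0 - Real.log p) (u - Real.log p)).comp_sub_right (Real.log p)
  have iQ' : IntervalIntegrable (fun x => logScale α Q (x - Real.log q)) MeasureTheory.volume 0 u := by
    simpa using (iQ (0 - Real.log q) (u - Real.log q)).comp_sub_right (Real.log q)
  have hmono := intervalIntegral.integral_mono_on hu
    (((iT 0 u).const_mul (p ^ (-α))).add ((iQ 0 u).const_mul (1 - 2 * p ^ (-α))))
    ((iT'.const_mul (p ^ (-α))).add (iQ'.const_mul (1 - 2 * p ^ (-α))))
    (fun x hx => h.logScale_step hx.1)
  rw [intervalIntegral.integral_add ((iT 0 u).const_mul _) ((iQ 0 u).const_mul _),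
    intervalIntegral.integral_add (iT'.const_mul _) (iQ'.const_mul _),
    intervalIntegral.integral_const_mul, intervalIntegral.integral_const_mul,
    intervalIntegral.integral_const_mul, intervalIntegral.integral_const_mul,
    intervalIntegral.integral_comp_sub_right, intervalIntegral.integral_comp_sub_right] at hmono
  have s1 := intervalIntegral.integral_interval_sub_interval_comm (iT (0 - Real.log p) (u - Real.log p))
    (iT 0 u) (iT _ _)
  have s2 := intervalIntegral.integral_interval_sub_interval_comm (iQ (0 - Real.log q) (u - Real.log q))
    (iQ 0 u) (iQ _ _)
  have t1 := congrArg (p ^ (-α) * ·) s1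
  have t2 := congrArg ((1 - 2 * p ^ (-α)) * ·) s2
  simp only [mul_sub] at t1 t2
  linarith

/-- The bound of the asymptotic constant by the conserved integral. -/
theorem lower_mul_le_one (h : RenewalPair p q α T Q) (hT : ∀ y, y < 1 → T y ≤ 1)
    (hQ : ∀ y, y < 1 → Q y ≤ 0) {B : ℝ} (hB0 : 0 ≤ B) (hB : IsEventualLower p α T Q B) :
    B * (α * (Real.log p * (p ^ (-α) / (1 - p ^ (-α))) +
      Real.log q * (1 - 2 * p ^ (-α)))) ≤ 1 := by
  have hP := h.rpow_left_pos
  have hP2 := h.rpow_left_lt_half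
  have hw := h.weight_pos
  have hα := h.exponent_pos
  have hlp : 0 < Real.log p := Real.log_pos (by linarith [h.two_le_left])
  have hlq : 0 < Real.log q := Real.log_pos (by linarith [h.two_le_right])
  obtain ⟨N, hN, hB⟩ := hB
  -- Both windows ending at u lie beyond log N, where the lower bounds hold.
  set u := Real.log N + Real.log p + Real.log q
  have hlN : 0 ≤ Real.log N := Real.log_nonneg hN
  have hlow : ∀ x, Real.log N ≤ x →
      B ≤ logScale α T x ∧ B * (1 - p ^ (-α)) ≤ logScale α Q x := by
    intro x hx
    have hx' := hB (Real.exp x) ((Real.log_le_iff_le_exp (by linarith)).1 hx)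
    have e := Real.exp_pos (-α * x)
    have hle : Real.exp x ^ α ≤ (Real.exp x + 1) ^ α :=
      Real.rpow_le_rpow (Real.exp_pos x).le (by linarith) hα.le
    have e1 := exp_rpow_mul_exp α x
    constructor
    · calc B = B * Real.exp x ^ α * Real.exp (-α * x) := by rw [mul_assoc, e1, mul_one]
        _ ≤ B * (Real.exp x + 1) ^ α * Real.exp (-α * x) := by gcongr
        _ ≤ logScale α T x := mul_le_mul_of_nonneg_right hx'.1 e.le
    · calc B * (1 - p ^ (-α)) = B * ((1 - p ^ (-α)) * Real.exp x ^ α) * Real.exp (-α * x) := by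
            rw [mul_assoc, mul_assoc, e1, mul_one]
        _ ≤ B * ((1 - p ^ (-α)) * (Real.exp x + 1) ^ α) * Real.exp (-α * x) := by gcongr
        _ ≤ logScale α Q x := mul_le_mul_of_nonneg_right hx'.2 e.le
  have iT := intervalIntegrable_logScale α h.monoT
  have iQ := intervalIntegrable_logScale α h.monoQ
  have l1 : Real.log p * B ≤ ∫ x in (u - Real.log p)..u, logScale α T x := by
    have := intervalIntegral.integral_mono_on (a := u - Real.log p) (b := u) (by linarith)
      intervalIntegrable_const (iT _ _)
      (fun x hx => (hlow x (by have := hx.1; simp only [u] at this; linarith)).1)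
    rwa [intervalIntegral.integral_const, smul_eq_mul, sub_sub_cancel] at this
  have l2 : Real.log q * (B * (1 - p ^ (-α))) ≤ ∫ x in (u - Real.log q)..u, logScale α Q x := by
    have := intervalIntegral.integral_mono_on (a := u - Real.log q) (b := u) (by linarith)
      intervalIntegrable_const (iQ _ _)
      (fun x hx => (hlow x (by have := hx.1; simp only [u] at this; linarith)).2)
    rwa [intervalIntegral.integral_const, smul_eq_mul, sub_sub_cancel] at this
  have u1 : ∫ x in (0 - Real.log p)..0, logScale α T x ≤ (1 / p ^ (-α) - 1) / α := by
    have := intervalIntegral.integral_mono_on_of_le_Ioo (a := 0 - Real.log p) (b := 0) (by linarith)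
      (iT _ _) (Continuous.intervalIntegrable (u := fun x => Real.exp (-α * x)) (by fun_prop) _ _)
      (fun x hx => mul_le_of_le_one_left (Real.exp_pos _).le
        (hT _ (Real.exp_lt_one_iff.2 hx.2)))
    refine this.trans_eq ?_
    rw [intervalIntegral.integral_comp_mul_left (fun x => Real.exp x) (neg_ne_zero.2 hα.ne'),
      integral_exp, Real.rpow_def_of_pos h.left_pos, one_div (Real.exp _), ← Real.exp_neg,
      smul_eq_mul, mul_zero, Real.exp_zero,
      show -α * (0 - Real.log p) = -(Real.log p * -α) by ring]
    field_simp
    ring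
  have u2 : ∫ x in (0 - Real.log q)..0, logScale α Q x ≤ 0 := by
    have := intervalIntegral.integral_mono_on_of_le_Ioo (a := 0 - Real.log q) (b := 0) (by linarith)
      (iQ _ _) (intervalIntegrable_const (c := (0 : ℝ)))
      (fun x hx => mul_nonpos_of_nonpos_of_nonneg (hQ _ (Real.exp_lt_one_iff.2 hx.2)) (Real.exp_pos _).le)
    simpa using this
  have main := h.logScale_integral_le (u := u) (by simp only [u]; linarith)
  have hD : 0 ≤ 1 - 2 * p ^ (-α) := by linarith
  have m1 := mul_le_mul_of_nonneg_left l1 hP.le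
  have m2 := mul_le_mul_of_nonneg_left l2 hD
  have m3 := mul_le_mul_of_nonneg_left u1 hP.le
  have m4 := mul_le_mul_of_nonneg_left u2 hD
  have m5 : p ^ (-α) * ((1 / p ^ (-α) - 1) / α) = (1 - p ^ (-α)) / α := by field_simp
  have m6 : (p ^ (-α) * (Real.log p * B) + (1 - 2 * p ^ (-α)) * (Real.log q * (B * (1 - p ^ (-α)))))
      ≤ (1 - p ^ (-α)) / α := by linarith
  rw [le_div_iff₀ hα] at m6
  refine le_of_mul_le_mul_right ?_ hw
  calc _ = (p ^ (-α) * (Real.log p * B) +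
        (1 - 2 * p ^ (-α)) * (Real.log q * (B * (1 - p ^ (-α))))) * α := by
        field_simp
    _ ≤ _ := by linarith

end RenewalPair

/-! ### The exponent and the irrationality of log p / log q -/

theorem one_div_rpow_add_sub {p q α : ℝ} (hp : 0 < p) (hq : 0 < q) :
    1 / p ^ α + 1 / q ^ α - 1 / (p * q) ^ α = 1 - (1 - p ^ (-α)) * (1 - q ^ (-α)) := by
  rw [Real.mul_rpow hp.le hq.le, Real.rpow_neg hp.le, Real.rpow_neg hq.le, one_div, one_div,
    one_div, mul_inv]
  ring

theorem one_sub_rpow_neg_strictMono {p : ℝ} (hp : 1 < p) :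
    StrictMono fun α : ℝ => 1 - p ^ (-α) := by
  intro a b hab
  have := Real.rpow_lt_rpow_of_exponent_lt hp (neg_lt_neg hab)
  simp only
  linarith

theorem one_sub_rpow_neg_pos {p α : ℝ} (hp : 1 < p) (hα : 0 < α) : 0 < 1 - p ^ (-α) := by
  have := Real.rpow_lt_one_of_one_lt_of_neg hp (neg_lt_zero.2 hα)
  linarith

theorem rpow_product_lt {p q a b : ℝ} (hp : 1 < p) (hq : 1 < q) (ha : 0 < a) (hab : a < b) :
    (1 - p ^ (-a)) * (1 - q ^ (-a)) < (1 - p ^ (-b)) * (1 - q ^ (-b)) :=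
  mul_lt_mul'' (one_sub_rpow_neg_strictMono hp hab) (one_sub_rpow_neg_strictMono hq hab)
    (one_sub_rpow_neg_pos hp ha).le (one_sub_rpow_neg_pos hq ha).le

theorem isPositiveExponent_iff {p q : ℕ} (hp : 1 < p) (hq : 1 < q) (α : ℝ) :
    IsPositiveExponent p q α ↔
      0 < α ∧ (1 - (p : ℝ) ^ (-α)) * (1 - (q : ℝ) ^ (-α)) = 1 / 2 := by
  have hp' : (0 : ℝ) < p := by exact_mod_cast (by omega : 0 < p)
  have hq' : (0 : ℝ) < q := by exact_mod_cast (by omega : 0 < q)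
  rw [IsPositiveExponent, one_div_rpow_add_sub hp' hq']
  refine and_congr_right fun _ => ⟨fun h => ?_, fun h => ?_⟩ <;> linarith

theorem existsUnique_isPositiveExponent {p q : ℕ} (hp : 1 < p) (hq : 1 < q) :
    ∃! α : ℝ, IsPositiveExponent p q α := by
  have hp1 : (1 : ℝ) < p := by exact_mod_cast hp
  have hq1 : (1 : ℝ) < q := by exact_mod_cast hq
  have hp2 : (2 : ℝ) ≤ p := by exact_mod_cast hp
  have hq2 : (2 : ℝ) ≤ q := by exact_mod_cast hq
  simp only [isPositiveExponent_iff hp hq]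
  have hcont : ContinuousOn (fun α : ℝ => (1 - (p : ℝ) ^ (-α)) * (1 - (q : ℝ) ^ (-α)))
      (Set.Icc 0 2) := by
    refine Continuous.continuousOn (Continuous.mul ?_ ?_)
    · exact continuous_const.sub (Real.continuous_const_rpow (by positivity) |>.comp continuous_neg)
    · exact continuous_const.sub (Real.continuous_const_rpow (by positivity) |>.comp continuous_neg)
  -- At exponent 2 the product is at least 9/16 > 1/2, and at exponent 0 it vanishes; this brackets
  -- the solution.
  have hbound : ∀ x : ℝ, 2 ≤ x → 3 / 4 ≤ 1 - x ^ (-(2 : ℝ)) := by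
    intro x hx
    rw [Real.rpow_neg (by linarith), Real.rpow_two]
    have : (x ^ 2)⁻¹ ≤ (4 : ℝ)⁻¹ := inv_anti₀ (by norm_num) (by nlinarith)
    linarith
  obtain ⟨α, hα, hα'⟩ := intermediate_value_Icc (by norm_num) hcont
    (show (1 / 2 : ℝ) ∈ _ by
      refine ⟨by simp, ?_⟩
      have := mul_le_mul (hbound p hp2) (hbound q hq2) (by norm_num)
        (by linarith [hbound p hp2])
      linarith)
  have hα0 : 0 < α := by
    rcases hα.1.eq_or_lt with h | h
    · subst h
      norm_num at hα'
    · exact h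
  refine ⟨α, ⟨hα0, hα'⟩, ?_⟩
  rintro β ⟨hβ0, hβ⟩
  rcases lt_trichotomy β α with h | h | h
  · have := rpow_product_lt hp1 hq1 hβ0 h
    linarith
  · exact h
  · have := rpow_product_lt hp1 hq1 hα0 h
    linarith

theorem irrational_log_div_log {p q : ℕ} (hp : 1 < p) (hq : 1 < q) (hpq : p.Coprime q) :
    Irrational (Real.log p / Real.log q) := by
  have hp1 : (1 : ℝ) < p := by exact_mod_cast hp
  have hq1 : (1 : ℝ) < q := by exact_mod_cast hq
  have hlp := Real.log_pos hp1
  have hlq := Real.log_pos hq1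
  rintro ⟨r, hr⟩
  have hr0 : (0 : ℝ) < r := by rw [hr]; positivity
  have hnum : 0 < r.num := Rat.num_pos.2 (by exact_mod_cast hr0)
  obtain ⟨n, hn⟩ : ∃ n : ℕ, r.num = n := ⟨r.num.toNat, by omega⟩
  have hden : (0 : ℝ) < r.den := by exact_mod_cast r.den_pos
  rw [Rat.cast_def, hn, div_eq_div_iff hden.ne' hlq.ne'] at hr
  push_cast at hr
  have h1 : Real.log ((q : ℝ) ^ n) = Real.log ((p : ℝ) ^ r.den) := by
    rw [Real.log_pow, Real.log_pow]
    linarith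
  have h2 := Real.log_injOn_pos (Set.mem_Ioi.2 (by positivity)) (Set.mem_Ioi.2 (by positivity)) h1
  have h3 : q ^ n = p ^ r.den := by exact_mod_cast h2
  have h4 : (p ^ r.den).Coprime (q ^ n) := Nat.Coprime.pow _ _ hpq
  rw [h3, Nat.coprime_self] at h4
  have h5 : 1 < p ^ r.den := Nat.one_lt_pow r.den_pos.ne' hp
  omega

/-! ### Asymptotics and the bound for chain counts -/

/-- The recursions mix n and n - 1. Monotonicity replaces all arguments by n for the upper
inequalities and by n - 1 for the lower ones; substituting Q into T(n) = Q(n) + T(n / p) gives the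
coefficients 2. -/
theorem renewalPair_chainCount {p q : ℕ} (hp : 1 < p) (hq : 1 < q) (hpq : p.Coprime q) {α : ℝ}
    (hα : IsPositiveExponent p q α) :
    RenewalPair p q α (fun y => chainCount p q ⌊y⌋₊) (fun y => primitiveCount p q ⌊y⌋₊) := by
  obtain ⟨hα0, hαe⟩ := (isPositiveExponent_iff hp hq α).1 hα
  have hfloor : ∀ y : ℝ, 1 ≤ y → 1 ≤ ⌊y⌋₊ := fun y hy => Nat.le_floor (by simpa using hy)
  have hmono : ∀ m n k : ℕ, m ≤ n → primitiveCount p q (m / k) ≤ primitiveCount p q (n / k) :=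
    fun m n k h => primitiveCount_mono p q (Nat.div_le_div_right h)
  have hmono' : ∀ m n k : ℕ, m ≤ n → chainCount p q (m / k) ≤ chainCount p q (n / k) :=
    fun m n k h => chainCount_mono p q (Nat.div_le_div_right h)
  refine
    { two_le_left := by exact_mod_cast hp
      two_le_right := by exact_mod_cast hq
      exponent_pos := hα0
      exponent_eq := hαe
      irrational := irrational_log_div_log hp hq hpq
      monoT := fun x y h => Nat.cast_le.2 (chainCount_mono p q (Nat.floor_mono h))
      monoQ := fun x y h => Nat.cast_le.2 (primitiveCount_mono p q (Nat.floor_mono h))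
      posT := fun y => ?_
      nonnegQ := fun y => Nat.cast_nonneg _
      posQ := ?_
      T_le := fun y hy => ?_
      Q_le := fun y hy => ?_
      le_T := fun y hy => ?_
      le_Q := fun y hy => ?_ }
  · have := chainCount_mono p q (Nat.zero_le ⌊y⌋₊)
    rw [chainCount_zero hp hq] at this
    exact_mod_cast this
  · have := primitiveCount_eq hp hq hpq (le_refl 1)
    rw [Nat.sub_self, Nat.zero_div, chainCount_zero hp hq] at this
    simp only [Nat.floor_one, Nat.cast_pos]
    omega
  all_goals
    simp only [Nat.floor_div_natCast, Nat.floor_sub_one]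
    have h1 := chainCount_eq hp hpq ⌊y⌋₊
    have h2 := primitiveCount_eq hp hq hpq (hfloor y hy)
    have h3 := hmono (⌊y⌋₊ - 1) ⌊y⌋₊ q (Nat.sub_le _ _)
    have h4 := hmono' (⌊y⌋₊ - 1) ⌊y⌋₊ p (Nat.sub_le _ _)
    norm_cast
    omega

theorem exists_limit_chainCount {p q : ℕ} (hp : 1 < p) (hq : 1 < q) (hpq : p.Coprime q) :
    ∃ C α : ℝ, 0 < C ∧ IsPositiveExponent p q α ∧
      (∀ A, C < A → RenewalPair.IsEventualUpper p α (fun y => chainCount p q ⌊y⌋₊)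
        (fun y => primitiveCount p q ⌊y⌋₊) A) ∧
      ∀ B, 0 < B → B < C → RenewalPair.IsEventualLower p α (fun y => chainCount p q ⌊y⌋₊)
        (fun y => primitiveCount p q ⌊y⌋₊) B := by
  obtain ⟨α, hα, -⟩ := existsUnique_isPositiveExponent hp hq
  obtain ⟨C, hC, h⟩ := (renewalPair_chainCount hp hq hpq hα).exists_limit
  exact ⟨C, α, hC, hα, h⟩

theorem isEquivalent_chainedSum {p q : ℕ} (hp : 1 < p) (hq : 1 < q) {C α : ℝ} (hC : 0 < C)
    (hα : 0 < α)
    (hup : ∀ A, C < A → RenewalPair.IsEventualUpper p α (fun y => chainCount p q ⌊y⌋₊)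
        (fun y => primitiveCount p q ⌊y⌋₊) A)
    (hlow : ∀ B, 0 < B → B < C → RenewalPair.IsEventualLower p α (fun y => chainCount p q ⌊y⌋₊)
        (fun y => primitiveCount p q ⌊y⌋₊) B) :
    (chainedSum p q) ~[Filter.atTop] (fun x : ℝ => C * x ^ α) := by
  rw [Asymptotics.IsEquivalent, Asymptotics.isLittleO_iff]
  intro ε hε
  set η := min ε 1
  have hη : 0 < η := lt_min hε one_pos
  have hηε : η ≤ ε := min_le_left _ _
  have hη1 : η ≤ 1 := min_le_right _ _
  obtain ⟨N, hN, hN'⟩ := hup (C * (1 + η)) (by nlinarith)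
  -- Only half of η is spent here. The other half pays for the empty chain, as C x^α η ≥ 2 for large
  -- x.
  obtain ⟨M, hM, hM'⟩ := hlow (C * (1 - η / 2)) (by nlinarith) (by nlinarith)
  filter_upwards [Filter.eventually_ge_atTop N, Filter.eventually_ge_atTop M,
    (tendsto_rpow_atTop hα).eventually_ge_atTop (2 / (C * η))] with x hx1 hx2 hx3
  have hx0 : 0 < x := by linarith
  have hT := chainedSum_add_one hp hq x
  have h1 := (hN' x hx1).1
  have h2 := (hM' x hx2).1
  simp only at h1 h2
  rw [← hT] at h1 h2
  have h3 : x ^ α ≤ (x + 1) ^ α := Real.rpow_le_rpow hx0.le (by linarith) hα.le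
  have hR : 0 < x ^ α := Real.rpow_pos_of_pos hx0 _
  rw [div_le_iff₀ (by positivity)] at hx3
  have h4 : C * (1 - η / 2) * x ^ α ≤ C * (1 - η / 2) * (x + 1) ^ α :=
    mul_le_mul_of_nonneg_left h3 (by nlinarith)
  have h5 : η * (C * x ^ α) ≤ ε * (C * x ^ α) := by gcongr
  rw [Pi.sub_apply, Real.norm_eq_abs, Real.norm_eq_abs, abs_of_pos (mul_pos hC hR), abs_le]
  constructor <;> nlinarith

theorem limit_lt {p q : ℕ} (hp : 1 < p) (hq : 1 < q) (hpq : p.Coprime q) {C α : ℝ} (hC : 0 < C)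
    (hα : IsPositiveExponent p q α)
    (hlow : ∀ B, 0 < B → B < C → RenewalPair.IsEventualLower p α (fun y => chainCount p q ⌊y⌋₊)
        (fun y => primitiveCount p q ⌊y⌋₊) B) :
    C < 2 * (Real.log ((p : ℝ) ^ α) / ((p : ℝ) ^ α - 1) +
      Real.log ((q : ℝ) ^ α) / ((q : ℝ) ^ α - 1))⁻¹ := by
  have h := renewalPair_chainCount hp hq hpq hα
  have hp1 : (1 : ℝ) < p := by exact_mod_cast hp
  have hq1 : (1 : ℝ) < q := by exact_mod_cast hq
  have hpα : 1 < (p : ℝ) ^ α := Real.one_lt_rpow hp1 h.exponent_pos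
  have hqα : 1 < (q : ℝ) ^ α := Real.one_lt_rpow hq1 h.exponent_pos
  -- The factor 2 in the claim leaves slack, so B = 3/4 C is enough: it gives a constant 4/3 in
  -- place of 2.
  have key := h.lower_mul_le_one
    (fun y hy => by simp [Nat.floor_eq_zero.2 hy, chainCount_zero hp hq])
    (fun y hy => by simp [Nat.floor_eq_zero.2 hy, primitiveCount_zero hp hq])
    (B := 3 / 4 * C) (by positivity) (hlow _ (by positivity) (by linarith))
  have e1 : Real.log p * (((p : ℝ) ^ (-α)) / (1 - (p : ℝ) ^ (-α))) =
      Real.log p / ((p : ℝ) ^ α - 1) := by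
    have : (p : ℝ) ^ α - 1 ≠ 0 := by linarith
    rw [Real.rpow_neg h.left_pos.le]
    field_simp
  -- The exponent equation is equivalent to (1 - 2 p^(-α)) (q^α - 1) = 1, which makes the bound
  -- symmetric in p and q.
  have e2 : Real.log q * (1 - 2 * (p : ℝ) ^ (-α)) = Real.log q / ((q : ℝ) ^ α - 1) := by
    have hne : (q : ℝ) ^ α - 1 ≠ 0 := by linarith
    have h1 := h.exponent_eq
    have h2 : (q : ℝ) ^ (-α) * (q : ℝ) ^ α = 1 := by
      rw [← Real.rpow_add h.right_pos]
      simp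
    have h3 : (1 - 2 * (p : ℝ) ^ (-α)) * ((q : ℝ) ^ α - 1) = 1 := by
      linear_combination (2 * (q : ℝ) ^ α) * h1 + (2 - 2 * (p : ℝ) ^ (-α)) * h2
    rw [eq_div_iff hne, mul_assoc, h3, mul_one]
  rw [e1, e2, mul_add, ← mul_div_assoc, ← mul_div_assoc, ← Real.log_rpow h.left_pos,
    ← Real.log_rpow h.right_pos] at key
  have hD : 0 < Real.log ((p : ℝ) ^ α) / ((p : ℝ) ^ α - 1) +
      Real.log ((q : ℝ) ^ α) / ((q : ℝ) ^ α - 1) :=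
    add_pos (div_pos (Real.log_pos hpα) (by linarith)) (div_pos (Real.log_pos hqα) (by linarith))
  rw [← div_eq_mul_inv, lt_div_iff₀ hD]
  linarith

/-! ### Finite certificates for approximations of the constant -/

/-- Taking v-th powers turns a comparison with a rational power into one between natural numbers,
which an algorithm can check. -/
theorem pow_mul_pow_le_iff {v : ℕ} (hv : 0 < v) (x y k u : ℕ) :
    x ^ v * k ^ u ≤ y ^ v ↔ (x : ℝ) * (k : ℝ) ^ ((u : ℝ) / v) ≤ y := by
  have hk : ((k : ℝ) ^ ((u : ℝ) / v)) ^ v = (k : ℝ) ^ u := by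
    rw [← Real.rpow_natCast, ← Real.rpow_mul (Nat.cast_nonneg k),
      div_mul_cancel₀ _ (by positivity), Real.rpow_natCast]
  rw [← pow_le_pow_iff_left₀ (a := (x : ℝ) * (k : ℝ) ^ ((u : ℝ) / v)) (b := (y : ℝ))
      (by positivity) (Nat.cast_nonneg y) hv.ne', mul_pow, hk]
  norm_cast

theorem le_pow_mul_pow_iff {v : ℕ} (hv : 0 < v) (x y k u : ℕ) :
    y ^ v ≤ x ^ v * k ^ u ↔ (y : ℝ) ≤ x * (k : ℝ) ^ ((u : ℝ) / v) := by
  have hk : ((k : ℝ) ^ ((u : ℝ) / v)) ^ v = (k : ℝ) ^ u := by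
    rw [← Real.rpow_natCast, ← Real.rpow_mul (Nat.cast_nonneg k),
      div_mul_cancel₀ _ (by positivity), Real.rpow_natCast]
  rw [← pow_le_pow_iff_left₀ (a := (y : ℝ)) (b := (x : ℝ) * (k : ℝ) ^ ((u : ℝ) / v))
      (Nat.cast_nonneg y) (by positivity) hv.ne', mul_pow, hk]
  norm_cast

theorem div_le_rpow_neg_iff {p : ℕ} (hp : 0 < p) {d : ℕ} (hd : 0 < d) (i : ℕ) (β : ℝ) :
    (i : ℝ) / d ≤ (p : ℝ) ^ (-β) ↔ (i : ℝ) * (p : ℝ) ^ β ≤ d := by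
  have : 0 < (p : ℝ) ^ β := by positivity
  rw [Real.rpow_neg (Nat.cast_nonneg p), div_le_iff₀ (by positivity), ← div_eq_inv_mul,
    le_div_iff₀ this]

theorem rpow_neg_le_div_iff {p : ℕ} (hp : 0 < p) {d : ℕ} (hd : 0 < d) (i : ℕ) (β : ℝ) :
    (p : ℝ) ^ (-β) ≤ (i : ℝ) / d ↔ (d : ℝ) ≤ i * (p : ℝ) ^ β := by
  have : 0 < (p : ℝ) ^ β := by positivity
  rw [Real.rpow_neg (Nat.cast_nonneg p), le_div_iff₀ (by positivity), ← div_eq_inv_mul,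
    div_le_iff₀ this]

/-- A finite certificate for `(m - 1) / 2 ^ n ≤ C ≤ (m + 1) / 2 ^ n`. The exponents
`u₁ / v` and `u₂ / v` enclose `α`, the fractions with denominator `d` are bounds of their
negative powers, and the inequalities for `T` and `Q` on a window propagate to infinity. -/
def IsCertificate (p q n : ℕ) (T Q : ℕ → ℕ) (m N v u₁ u₂ d a₁ b₁ a₂ b₂ e₁ e₂ : ℕ) : Prop :=
  (0 < N ∧ 0 < v ∧ 0 < d) ∧
  (a₁ ^ v * p ^ u₁ ≤ d ^ v ∧ b₁ ^ v * q ^ u₁ ≤ d ^ v ∧ 2 * ((d - a₁) * (d - b₁)) < d * d) ∧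
  (d ^ v ≤ a₂ ^ v * p ^ u₂ ∧ d ^ v ≤ b₂ ^ v * q ^ u₂ ∧ d * d < 2 * ((d - a₂) * (d - b₂))) ∧
  (e₁ ^ v * p ^ u₂ ≤ d ^ v ∧ d ^ v ≤ e₂ ^ v * p ^ u₁) ∧
  ∀ k ∈ List.range (2 * (p * q) * N + 1), k < N ∨
    (((T k * 2 ^ n) ^ v ≤ (m + 1) ^ v * k ^ u₁ ∧
      (Q k * 2 ^ n * d) ^ v ≤ ((m + 1) * (d - e₂)) ^ v * k ^ u₁) ∧
    ((m - 1) ^ v * (k + 2) ^ u₂ ≤ (T k * 2 ^ n) ^ v ∧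
      ((m - 1) * (d - e₁)) ^ v * (k + 2) ^ u₂ ≤ (Q k * 2 ^ n * d) ^ v))

theorem rpow_product_le {p q a b : ℝ} (hp : 1 < p) (hq : 1 < q) (ha : 0 ≤ a) (hab : a ≤ b) :
    (1 - p ^ (-a)) * (1 - q ^ (-a)) ≤ (1 - p ^ (-b)) * (1 - q ^ (-b)) := by
  have h : ∀ x : ℝ, 1 < x → 0 ≤ 1 - x ^ (-a) := by
    intro x hx
    have := (one_sub_rpow_neg_strictMono hx).monotone ha
    simpa using this
  exact mul_le_mul ((one_sub_rpow_neg_strictMono hp).monotone hab)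
    ((one_sub_rpow_neg_strictMono hq).monotone hab) (h q hq)
    ((h p hp).trans ((one_sub_rpow_neg_strictMono hp).monotone hab))

theorem lt_of_product_lt_half {p q α β x y : ℝ} (hp : 1 < p) (hq : 1 < q) (hα : 0 < α)
    (he : (1 - p ^ (-α)) * (1 - q ^ (-α)) = 1 / 2) (hx : x ≤ p ^ (-β))
    (hy : y ≤ q ^ (-β)) (h : (1 - x) * (1 - y) < 1 / 2) : β < α := by
  by_contra! hαβ
  have h1 := rpow_product_le hp hq hα.le hαβ
  have h2 : (1 - p ^ (-β)) * (1 - q ^ (-β)) ≤ (1 - x) * (1 - y) := by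
    have h3 : p ^ (-β) ≤ 1 := Real.rpow_le_one_of_one_le_of_nonpos hp.le (by linarith)
    have h4 : q ^ (-β) ≤ 1 := Real.rpow_le_one_of_one_le_of_nonpos hq.le (by linarith)
    exact mul_le_mul (by linarith) (by linarith) (by linarith) (by linarith)
  linarith

theorem lt_of_half_lt_product {p q α γ x y : ℝ} (hp : 1 < p) (hq : 1 < q)
    (hγ : 0 ≤ γ) (he : (1 - p ^ (-α)) * (1 - q ^ (-α)) = 1 / 2) (hx : p ^ (-γ) ≤ x)
    (hy : q ^ (-γ) ≤ y) (hx1 : x ≤ 1) (hy1 : y ≤ 1) (h : 1 / 2 < (1 - x) * (1 - y)) : α < γ := by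
  by_contra! hαγ
  have h1 := rpow_product_le hp hq hγ hαγ
  have h2 : (1 - x) * (1 - y) ≤ (1 - p ^ (-γ)) * (1 - q ^ (-γ)) :=
    mul_le_mul (by linarith) (by linarith) (by linarith) (by linarith)
  linarith

theorem one_sub_div_eq {d : ℕ} (hd : 0 < d) {i : ℕ} (hi : i ≤ d) :
    1 - (i : ℝ) / d = ((d - i : ℕ) : ℝ) / d := by
  rw [Nat.cast_sub hi]
  field_simp

/-- The products compared with 1/2 force u₁ / v < α < u₂ / v, and e₁ / d, e₂ / d enclose p^(-α).
Checking integers k = ⌊y⌋ suffices: k^β ≤ y^α above, and (y + 1)^α ≤ (k + 2)^γ below, because y + 1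
< k + 2. The extension lemmas then make (m + 1) / 2^n and (m - 1) / 2^n eventual bounds, which
enclose C. -/
theorem IsCertificate.abs_sub_le {p q n : ℕ} {m N v u₁ u₂ d a₁ b₁ a₂ b₂ e₁ e₂ : ℕ} (hp : 1 < p)
    (hq : 1 < q) (hpq : p.Coprime q) {C α : ℝ} (hα : IsPositiveExponent p q α)
    (hup : ∀ A, C < A → RenewalPair.IsEventualUpper p α (fun y => chainCount p q ⌊y⌋₊)
        (fun y => primitiveCount p q ⌊y⌋₊) A)
    (hlow : ∀ B, 0 < B → B < C → RenewalPair.IsEventualLower p α (fun y => chainCount p q ⌊y⌋₊)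
        (fun y => primitiveCount p q ⌊y⌋₊) B)
    (h : IsCertificate p q n (chainCount p q) (primitiveCount p q)
      m N v u₁ u₂ d a₁ b₁ a₂ b₂ e₁ e₂) :
    |C - m / 2 ^ n| ≤ 1 / 2 ^ n := by
  obtain ⟨⟨hN, hv, hd⟩, ⟨ha₁, hb₁, hab₁⟩, ⟨ha₂, hb₂, hab₂⟩, ⟨he₁, he₂⟩, hw⟩ := h
  have R := renewalPair_chainCount hp hq hpq hα
  have hp1 : (1 : ℝ) < p := by exact_mod_cast hp
  have hq1 : (1 : ℝ) < q := by exact_mod_cast hq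
  have hp0 : 0 < p := by omega
  have hq0 : 0 < q := by omega
  have hN1 : (1 : ℝ) ≤ N := by exact_mod_cast hN
  have hd0 : (0 : ℝ) < d := by exact_mod_cast hd
  rw [pow_mul_pow_le_iff hv, ← div_le_rpow_neg_iff (by assumption) hd] at ha₁ hb₁ he₁
  rw [le_pow_mul_pow_iff hv, ← rpow_neg_le_div_iff (by assumption) hd] at ha₂ hb₂ he₂
  set β : ℝ := (u₁ : ℝ) / v
  set γ : ℝ := (u₂ : ℝ) / v
  have hβ0 : 0 ≤ β := by positivity
  have hγ0 : 0 ≤ γ := by positivity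
  have hle : ∀ {x : ℕ} {i : ℕ} {δ : ℝ}, 1 < x → 0 ≤ δ → (i : ℝ) / d ≤ (x : ℝ) ^ (-δ) → i ≤ d := by
    intro x i δ hx hδ hi
    have h1 : (x : ℝ) ^ (-δ) ≤ 1 :=
      Real.rpow_le_one_of_one_le_of_nonpos (by exact_mod_cast hx.le) (by linarith)
    have := (div_le_one hd0).1 (hi.trans h1)
    exact_mod_cast this
  have hα0 := R.exponent_pos
  have hβα : β < α := by
    refine lt_of_product_lt_half hp1 hq1 hα0 R.exponent_eq ha₁ hb₁ ?_
    rw [one_sub_div_eq hd (hle hp hβ0 ha₁), one_sub_div_eq hd (hle hq hβ0 hb₁), div_mul_div_comm,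
      div_lt_div_iff₀ (by positivity) two_pos]
    have : (2 : ℝ) * (((d - a₁ : ℕ) : ℝ) * ((d - b₁ : ℕ) : ℝ)) < d * d := by exact_mod_cast hab₁
    linarith
  have hαγ : α < γ := by
    have hpos : 0 < (d - a₂) * (d - b₂) := by
      by_contra! h0
      have := Nat.le_zero.1 h0
      rw [this] at hab₂
      omega
    have ha := (Nat.pos_of_mul_pos_right hpos : 0 < d - a₂)
    have hb := (Nat.pos_of_mul_pos_left hpos : 0 < d - b₂)
    refine lt_of_half_lt_product hp1 hq1 hγ0 R.exponent_eq ha₂ hb₂ ?_ ?_ ?_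
    · rw [div_le_one hd0]
      exact_mod_cast (by omega : a₂ ≤ d)
    · rw [div_le_one hd0]
      exact_mod_cast (by omega : b₂ ≤ d)
    rw [one_sub_div_eq hd (by omega), one_sub_div_eq hd (by omega), div_mul_div_comm,
      div_lt_div_iff₀ two_pos (by positivity)]
    have : (d : ℝ) * d < 2 * (((d - a₂ : ℕ) : ℝ) * ((d - b₂ : ℕ) : ℝ)) := by exact_mod_cast hab₂
    linarith
  have hP1 : (p : ℝ) ^ (-α) ≤ (e₂ : ℝ) / d :=
    (Real.rpow_le_rpow_of_exponent_le hp1.le (by linarith)).trans he₂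
  have hP2 : (e₁ : ℝ) / d ≤ (p : ℝ) ^ (-α) :=
    he₁.trans (Real.rpow_le_rpow_of_exponent_le hp1.le (by linarith))
  have hw0 := R.weight_pos
  have hs1 : ((d - e₂ : ℕ) : ℝ) / d ≤ 1 - (p : ℝ) ^ (-α) := by
    rcases le_total e₂ d with h | h
    · rw [← one_sub_div_eq hd h]
      linarith
    · rw [Nat.sub_eq_zero_of_le h, Nat.cast_zero, zero_div]
      exact hw0.le
  have hs2 : 1 - (p : ℝ) ^ (-α) ≤ ((d - e₁ : ℕ) : ℝ) / d := by
    rw [← one_sub_div_eq hd (hle hp hγ0 he₁)]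
    linarith
  rw [div_le_iff₀ hd0] at hs1
  rw [le_div_iff₀ hd0] at hs2
  have h2n : (0 : ℝ) < 2 ^ n := by positivity
  have hwin : ∀ y : ℝ, N ≤ y → y ≤ 2 * (p * q) * N → (1 ≤ ⌊y⌋₊) ∧
      (((chainCount p q ⌊y⌋₊ * 2 ^ n) ^ v ≤ (m + 1) ^ v * ⌊y⌋₊ ^ u₁ ∧
      (primitiveCount p q ⌊y⌋₊ * 2 ^ n * d) ^ v ≤ ((m + 1) * (d - e₂)) ^ v * ⌊y⌋₊ ^ u₁) ∧
      ((m - 1) ^ v * (⌊y⌋₊ + 2) ^ u₂ ≤ (chainCount p q ⌊y⌋₊ * 2 ^ n) ^ v ∧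
      ((m - 1) * (d - e₁)) ^ v * (⌊y⌋₊ + 2) ^ u₂ ≤
        (primitiveCount p q ⌊y⌋₊ * 2 ^ n * d) ^ v)) := by
    intro y h1 h2
    have h3 : N ≤ ⌊y⌋₊ := Nat.le_floor h1
    have h4 : ⌊y⌋₊ ≤ 2 * (p * q) * N := Nat.floor_le_of_le (by exact_mod_cast h2)
    rcases hw ⌊y⌋₊ (List.mem_range.2 (by omega)) with h | h
    · omega
    · exact ⟨by omega, h⟩
  have hupper : RenewalPair.IsEventualUpper p α (fun y => chainCount p q ⌊y⌋₊)
      (fun y => primitiveCount p q ⌊y⌋₊) ((m + 1) / 2 ^ n) := by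
    refine ⟨N, hN1, R.upper_extend hN1 fun y h1 h2 => ?_⟩
    have h3 := (R.window_le hN1).2.2
    obtain ⟨hk, ⟨g1, g2⟩, -⟩ := hwin y h1 (by linarith)
    rw [le_pow_mul_pow_iff hv] at g1 g2
    change _ ≤ _ * _ ^ β at g1
    change _ ≤ _ * _ ^ β at g2
    push_cast at g1 g2
    have hk1 : (1 : ℝ) ≤ (⌊y⌋₊ : ℝ) := by exact_mod_cast hk
    have hky : (⌊y⌋₊ : ℝ) ≤ y := Nat.floor_le (by linarith)
    have hkβ : (⌊y⌋₊ : ℝ) ^ β ≤ y ^ α :=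
      (Real.rpow_le_rpow_of_exponent_le hk1 hβα.le).trans
        (Real.rpow_le_rpow (by linarith) hky hα0.le)
    constructor
    · rw [div_mul_eq_mul_div, le_div_iff₀ h2n]
      exact g1.trans (by gcongr)
    · rw [div_mul_eq_mul_div, le_div_iff₀ h2n]
      refine le_of_mul_le_mul_right ?_ hd0
      refine g2.trans ?_
      calc ((m : ℝ) + 1) * ((d - e₂ : ℕ) : ℝ) * (⌊y⌋₊ : ℝ) ^ β
          ≤ (m + 1) * ((1 - (p : ℝ) ^ (-α)) * d) * y ^ α := by gcongr
        _ = _ := by ring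
  have hlower : RenewalPair.IsEventualLower p α (fun y => chainCount p q ⌊y⌋₊)
      (fun y => primitiveCount p q ⌊y⌋₊) ((m - 1 : ℕ) / 2 ^ n) := by
    refine ⟨N, hN1, R.lower_extend (by positivity) hN1 fun y h1 h2 => ?_⟩
    obtain ⟨hk, -, g1, g2⟩ := hwin y h1 h2
    rw [pow_mul_pow_le_iff hv] at g1 g2
    change _ * _ ^ γ ≤ _ at g1
    change _ * _ ^ γ ≤ _ at g2
    push_cast at g1 g2
    have hky : y + 1 ≤ (⌊y⌋₊ : ℝ) + 2 := by linarith [Nat.lt_floor_add_one y]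
    have hyα : 0 ≤ (y + 1) ^ α := Real.rpow_nonneg (by linarith) _
    have hkγ : (y + 1) ^ α ≤ ((⌊y⌋₊ : ℝ) + 2) ^ γ :=
      (Real.rpow_le_rpow (by linarith) hky hα0.le).trans
        (Real.rpow_le_rpow_of_exponent_le (by linarith) hαγ.le)
    constructor
    · rw [div_mul_eq_mul_div, div_le_iff₀ h2n]
      exact le_trans (by gcongr) g1
    · rw [div_mul_eq_mul_div, div_le_iff₀ h2n]
      refine le_of_mul_le_mul_right ?_ hd0
      refine le_trans ?_ g2
      calc ((m - 1 : ℕ) : ℝ) * ((1 - (p : ℝ) ^ (-α)) * (y + 1) ^ α) * d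
          = (m - 1 : ℕ) * ((1 - (p : ℝ) ^ (-α)) * d) * (y + 1) ^ α := by ring
        _ ≤ _ := by gcongr
  have hCu : C ≤ (m + 1) / 2 ^ n := by
    by_contra! hlt
    obtain ⟨B, hB1, hB2⟩ := exists_between hlt
    have := R.le_of_isEventual hupper (hlow B (lt_trans (by positivity) hB1) hB2)
    linarith
  have hCl : ((m - 1 : ℕ) : ℝ) / 2 ^ n ≤ C := by
    by_contra! hlt
    obtain ⟨A, hA1, hA2⟩ := exists_between hlt
    have := R.le_of_isEventual (hup A hA1) hlower
    linarith
  -- For m = 0 the truncated m - 1 is 0, which only strengthens the lower bound.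
  have hm : (m : ℝ) ≤ ((m - 1 : ℕ) : ℝ) + 1 := by exact_mod_cast (by omega : m ≤ (m - 1) + 1)
  have hm' : ((m : ℝ) - 1) / 2 ^ n ≤ ((m - 1 : ℕ) : ℝ) / 2 ^ n :=
    div_le_div_of_nonneg_right (by linarith) h2n.le
  rw [sub_div] at hm'
  rw [add_div] at hCu
  rw [abs_le]
  constructor <;> linarith

/-- Holding for all large denominators, this lets several fractions share one denominator. -/
theorem eventually_exists_div_mem {a b : ℝ} (ha : 0 ≤ a) (hab : a < b) :
    ∀ᶠ d : ℕ in Filter.atTop, ∃ i : ℕ, a < (i : ℝ) / d ∧ (i : ℝ) / d < b := by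
  obtain ⟨D, hD⟩ := exists_nat_gt (1 / (b - a))
  filter_upwards [Filter.eventually_ge_atTop (D + 1)] with d hd
  have hd1 : (D : ℝ) + 1 ≤ d := by exact_mod_cast hd
  have hD0 : (0 : ℝ) ≤ D := Nat.cast_nonneg D
  have hd0 : (0 : ℝ) < d := by linarith
  have hba : 1 < (b - a) * d := by
    have := (div_lt_iff₀ (sub_pos.2 hab)).1 (hD.trans (by linarith : (D : ℝ) < d))
    linarith
  refine ⟨⌊a * d⌋₊ + 1, ?_, ?_⟩
  · rw [lt_div_iff₀ hd0]
    push_cast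
    exact Nat.lt_floor_add_one _
  · rw [div_lt_iff₀ hd0]
    push_cast
    have := Nat.floor_le (mul_nonneg ha hd0.le)
    linarith

/-- With m = ⌊C 2^n⌋ the bounds (m ± 1) / 2^n differ strictly from C, so the window inequalities
hold strictly at the exponent α once N is large. They are finitely many and continuous in the
exponent, so they survive rational perturbation. -/
theorem exists_isCertificate {p q : ℕ} (n : ℕ) (hp : 1 < p)
    (hq : 1 < q) (hpq : p.Coprime q) {C α : ℝ} (hC : 0 < C) (hα : IsPositiveExponent p q α)
    (hup : ∀ A, C < A → RenewalPair.IsEventualUpper p α (fun y => chainCount p q ⌊y⌋₊)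
        (fun y => primitiveCount p q ⌊y⌋₊) A)
    (hlow : ∀ B, 0 < B → B < C → RenewalPair.IsEventualLower p α (fun y => chainCount p q ⌊y⌋₊)
        (fun y => primitiveCount p q ⌊y⌋₊) B) :
    ∃ m N v u₁ u₂ d a₁ b₁ a₂ b₂ e₁ e₂ : ℕ,
      IsCertificate p q n (chainCount p q) (primitiveCount p q)
        m N v u₁ u₂ d a₁ b₁ a₂ b₂ e₁ e₂ := by
  have R := renewalPair_chainCount hp hq hpq hα
  have hp1 : (1 : ℝ) < p := by exact_mod_cast hp
  have hq1 : (1 : ℝ) < q := by exact_mod_cast hq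
  have hp0 : 0 < p := by omega
  have hq0 : 0 < q := by omega
  have hw := R.weight_pos
  have hα0 := R.exponent_pos
  have h2n : (0 : ℝ) < 2 ^ n := by positivity
  set m := ⌊C * 2 ^ n⌋₊
  have hm1 : C < (m + 1) / 2 ^ n := (lt_div_iff₀ h2n).2 (Nat.lt_floor_add_one _)
  have hm2 : ((m - 1 : ℕ) : ℝ) / 2 ^ n < C := by
    rw [div_lt_iff₀ h2n]
    rcases Nat.eq_zero_or_pos m with h | h
    · rw [h]
      simp only [zero_tsub, Nat.cast_zero]
      positivity
    · rw [Nat.cast_sub h, Nat.cast_one]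
      have : (m : ℝ) ≤ C * 2 ^ n := Nat.floor_le (by positivity)
      linarith
  obtain ⟨A, hA1, hA2⟩ := exists_between hm1
  obtain ⟨B, hB1, hB2⟩ := exists_between hm2
  have hB0 : 0 < B := lt_of_le_of_lt (by positivity) hB1
  rw [lt_div_iff₀ h2n] at hA2
  rw [div_lt_iff₀ h2n] at hB1
  obtain ⟨N₁, -, hN₁⟩ := hup A hA1
  obtain ⟨N₂, -, hN₂⟩ := hlow B hB0 hB2
  -- The eventual lower bound involves k + 1 and the certificate k + 2; the ratio of their powers
  -- tends to 1 and fits into the strict gap below B.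
  have hshift : ∀ᶠ x : ℝ in Filter.atTop,
      ((m - 1 : ℕ) : ℝ) * (1 + (x + 1)⁻¹) ^ α < B * 2 ^ n := by
    have h1 : Filter.Tendsto (fun x : ℝ => (x + 1)⁻¹) Filter.atTop (nhds 0) :=
      tendsto_inv_atTop_zero.comp (Filter.tendsto_atTop_add_const_right _ 1 Filter.tendsto_id)
    have h2 : Filter.Tendsto (fun x : ℝ => ((m - 1 : ℕ) : ℝ) * (1 + (x + 1)⁻¹) ^ α) Filter.atTop
        (nhds (((m - 1 : ℕ) : ℝ) * (1 + 0) ^ α)) :=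
      ((h1.const_add 1).rpow_const (Or.inl (by norm_num))).const_mul _
    refine h2.eventually_lt_const ?_
    simpa using hB1
  obtain ⟨N₃, hN₃⟩ := Filter.eventually_atTop.1 hshift
  set N := max 1 (max ⌈N₁⌉₊ (max ⌈N₂⌉₊ ⌈N₃⌉₊))
  have hN : ∀ k : ℕ, N ≤ k → 1 ≤ k ∧ N₁ ≤ k ∧ N₂ ≤ k ∧ N₃ ≤ k := by
    intro k hk
    simp only [N, max_le_iff, Nat.ceil_le] at hk
    exact hk
  have hstrict : ∀ k : ℕ, N ≤ k →
      ((chainCount p q k : ℝ) * 2 ^ n < (m + 1) * (k : ℝ) ^ α ∧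
      (primitiveCount p q k : ℝ) * 2 ^ n < (m + 1) * ((1 - (p : ℝ) ^ (-α)) * (k : ℝ) ^ α)) ∧
      (((m - 1 : ℕ) : ℝ) * ((k : ℝ) + 2) ^ α < chainCount p q k * 2 ^ n ∧
      ((m - 1 : ℕ) : ℝ) * ((1 - (p : ℝ) ^ (-α)) * ((k : ℝ) + 2) ^ α) <
        primitiveCount p q k * 2 ^ n) := by
    intro k hk
    obtain ⟨k0, k1, k2, k3⟩ := hN k hk
    have hk0 : (1 : ℝ) ≤ k := by exact_mod_cast k0
    obtain ⟨g1, g2⟩ := hN₁ k k1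
    obtain ⟨g3, g4⟩ := hN₂ k k2
    have g5 := hN₃ k k3
    simp only [Nat.floor_natCast] at g1 g2 g3 g4
    have hR : 0 < (k : ℝ) ^ α := Real.rpow_pos_of_pos (by linarith) _
    have hR1 : 0 < ((k : ℝ) + 1) ^ α := Real.rpow_pos_of_pos (by linarith) _
    have e : ((k : ℝ) + 2) ^ α = (1 + ((k : ℝ) + 1)⁻¹) ^ α * ((k : ℝ) + 1) ^ α := by
      rw [← Real.mul_rpow (by positivity) (by positivity)]
      congr 1
      field_simp
      ring
    have g6 : ((m - 1 : ℕ) : ℝ) * ((k : ℝ) + 2) ^ α < B * 2 ^ n * ((k : ℝ) + 1) ^ α := by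
      rw [e, ← mul_assoc]
      exact mul_lt_mul_of_pos_right g5 hR1
    refine ⟨⟨?_, ?_⟩, ?_, ?_⟩
    · calc (chainCount p q k : ℝ) * 2 ^ n ≤ A * (k : ℝ) ^ α * 2 ^ n := by gcongr
        _ = A * 2 ^ n * (k : ℝ) ^ α := by ring
        _ < _ := by gcongr
    · calc (primitiveCount p q k : ℝ) * 2 ^ n
          ≤ A * ((1 - (p : ℝ) ^ (-α)) * (k : ℝ) ^ α) * 2 ^ n := by gcongr
        _ = A * 2 ^ n * ((1 - (p : ℝ) ^ (-α)) * (k : ℝ) ^ α) := by ring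
        _ < _ := by gcongr
    · calc _ < B * 2 ^ n * ((k : ℝ) + 1) ^ α := g6
        _ = B * ((k : ℝ) + 1) ^ α * 2 ^ n := by ring
        _ ≤ _ := by gcongr
    · calc ((m - 1 : ℕ) : ℝ) * ((1 - (p : ℝ) ^ (-α)) * ((k : ℝ) + 2) ^ α)
          = (1 - (p : ℝ) ^ (-α)) * (((m - 1 : ℕ) : ℝ) * ((k : ℝ) + 2) ^ α) := by ring
        _ < (1 - (p : ℝ) ^ (-α)) * (B * 2 ^ n * ((k : ℝ) + 1) ^ α) := by gcongr
        _ = B * ((1 - (p : ℝ) ^ (-α)) * ((k : ℝ) + 1) ^ α) * 2 ^ n := by ring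
        _ ≤ _ := by gcongr
  have hcont : ∀ x : ℝ, 0 < x → Continuous fun δ : ℝ => x ^ δ := fun x hx =>
    Real.continuous_const_rpow hx.ne'
  have hcontp : Continuous fun δ : ℝ => 1 - (p : ℝ) ^ (-δ) :=
    continuous_const.sub ((hcont p (by positivity)).comp continuous_neg)
  have hev : ∀ᶠ δ : ℝ in nhds α, 0 < δ ∧ ∀ k ∈ Finset.Icc N (2 * (p * q) * N),
      ((chainCount p q k : ℝ) * 2 ^ n < (m + 1) * (k : ℝ) ^ δ ∧
      (primitiveCount p q k : ℝ) * 2 ^ n < (m + 1) * ((1 - (p : ℝ) ^ (-δ)) * (k : ℝ) ^ δ)) ∧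
      (((m - 1 : ℕ) : ℝ) * ((k : ℝ) + 2) ^ δ < chainCount p q k * 2 ^ n ∧
      ((m - 1 : ℕ) : ℝ) * ((1 - (p : ℝ) ^ (-δ)) * ((k : ℝ) + 2) ^ δ) <
        primitiveCount p q k * 2 ^ n) := by
    refine (lt_mem_nhds hα0).and ((Finset.eventually_all _).2 fun k hk => ?_)
    have hkN := (Finset.mem_Icc.1 hk).1
    have hk0 : (0 : ℝ) < k := by exact_mod_cast (hN k hkN).1
    have c1 := hcont k hk0
    have c2 := hcont ((k : ℝ) + 2) (by positivity)
    obtain ⟨⟨s1, s2⟩, s3, s4⟩ := hstrict k hkN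
    refine ((?_ : ∀ᶠ δ in nhds α, _).and ?_).and ((?_ : ∀ᶠ δ in nhds α, _).and ?_)
    · exact (continuous_const.mul c1).continuousAt.eventually_const_lt s1
    · exact (continuous_const.mul (hcontp.mul c1)).continuousAt.eventually_const_lt s2
    · exact (continuous_const.mul c2).continuousAt.eventually_lt_const s3
    · exact (continuous_const.mul (hcontp.mul c2)).continuousAt.eventually_lt_const s4
  -- The exponents are ordered β₀ < β < β' < α < γ' < γ < γ₀. The outer two carry the window
  -- inequalities and leave room for e₁, e₂; the inner two leave room for the a and b fractions.
  obtain ⟨β₀, ⟨hβ₀, hβ₀k⟩, hβ₀α⟩ :=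
    ((hev.filter_mono nhdsWithin_le_nhds).and (self_mem_nhdsWithin (s := Set.Iio α))).exists
  obtain ⟨γ₀, ⟨hγ₀, hγ₀k⟩, hγ₀α⟩ :=
    ((hev.filter_mono nhdsWithin_le_nhds).and (self_mem_nhdsWithin (s := Set.Ioi α))).exists
  obtain ⟨v, ⟨hv, u₁, hu₁, hu₁'⟩, u₂, hu₂, hu₂'⟩ :=
    (((Filter.eventually_gt_atTop 0).and (eventually_exists_div_mem hβ₀.le hβ₀α)).and
      (eventually_exists_div_mem hα0.le hγ₀α)).exists
  set β : ℝ := (u₁ : ℝ) / v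
  set γ : ℝ := (u₂ : ℝ) / v
  obtain ⟨β', hβ', hβ'α⟩ := exists_between hu₁'
  obtain ⟨γ', hγ'α, hγ'⟩ := exists_between hu₂
  have hfrac : ∀ x : ℝ, 1 < x → ∀ δ ε : ℝ, ε < δ → ∀ᶠ d : ℕ in Filter.atTop, ∃ i : ℕ,
      x ^ (-δ) < (i : ℝ) / d ∧ (i : ℝ) / d < x ^ (-ε) := fun x hx δ ε h =>
    eventually_exists_div_mem (Real.rpow_nonneg (by linarith) _)
      (Real.rpow_lt_rpow_of_exponent_lt hx (by linarith))
  obtain ⟨d, hd, ⟨a₁, ha₁, ha₁'⟩, ⟨b₁, hb₁, hb₁'⟩, ⟨a₂, ha₂, ha₂'⟩, ⟨b₂, hb₂, hb₂'⟩,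
    ⟨e₁, he₁, he₁'⟩, ⟨e₂, he₂, he₂'⟩⟩ := ((Filter.eventually_gt_atTop 0).and
      ((hfrac p hp1 β' β hβ').and ((hfrac q hq1 β' β hβ').and ((hfrac p hp1 γ γ' hγ').and
      ((hfrac q hq1 γ γ' hγ').and ((hfrac p hp1 γ₀ γ hu₂').and (hfrac p hp1 β β₀ hu₁))))))).exists
  have hd0 : (0 : ℝ) < d := by exact_mod_cast hd
  have hle : ∀ {x i : ℕ} {δ : ℝ}, 1 < x → 0 ≤ δ → (i : ℝ) / d < (x : ℝ) ^ (-δ) → i ≤ d := by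
    intro x i δ hx hδ hi
    have h1 : (x : ℝ) ^ (-δ) ≤ 1 :=
      Real.rpow_le_one_of_one_le_of_nonpos (by exact_mod_cast hx.le) (by linarith)
    have := (div_le_one hd0).1 (hi.le.trans h1)
    exact_mod_cast this
  have hβ0 : 0 ≤ β := by linarith
  have la₁ := hle hp hβ0 ha₁'
  have lb₁ := hle hq hβ0 hb₁'
  have la₂ := hle hp (by linarith) ha₂'
  have lb₂ := hle hq (by linarith) hb₂'
  have le₁ := hle hp (by linarith) he₁'
  have le₂ := hle hp hβ₀.le he₂'
  have hfp : ∀ {i : ℕ}, i ≤ d → (0 : ℝ) ≤ 1 - (i : ℝ) / d := by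
    intro i hi
    rw [one_sub_div_eq hd hi]
    positivity
  refine ⟨m, N, v, u₁, u₂, d, a₁, b₁, a₂, b₂, e₁, e₂, ⟨by simp [N], hv, hd⟩, ⟨?_, ?_, ?_⟩,
    ⟨?_, ?_, ?_⟩, ⟨?_, ?_⟩, fun k hk => ?_⟩
  · rw [pow_mul_pow_le_iff hv, ← div_le_rpow_neg_iff hp0 hd]
    exact ha₁'.le
  · rw [pow_mul_pow_le_iff hv, ← div_le_rpow_neg_iff hq0 hd]
    exact hb₁'.le
  · have h1 : (1 - (a₁ : ℝ) / d) * (1 - (b₁ : ℝ) / d) < 1 / 2 := by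
      rw [← R.exponent_eq]
      refine lt_of_le_of_lt ?_ (rpow_product_lt hp1 hq1 (by linarith) hβ'α)
      have := hfp lb₁
      exact mul_le_mul (by linarith) (by linarith) this
        (one_sub_rpow_neg_pos hp1 (by linarith)).le
    rw [one_sub_div_eq hd la₁, one_sub_div_eq hd lb₁, div_mul_div_comm,
      div_lt_div_iff₀ (by positivity) two_pos] at h1
    have : (2 : ℝ) * (((d - a₁ : ℕ) : ℝ) * ((d - b₁ : ℕ) : ℝ)) < d * d := by linarith
    exact_mod_cast this
  · rw [le_pow_mul_pow_iff hv, ← rpow_neg_le_div_iff hp0 hd]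
    exact ha₂.le
  · rw [le_pow_mul_pow_iff hv, ← rpow_neg_le_div_iff hq0 hd]
    exact hb₂.le
  · have h1 : 1 / 2 < (1 - (a₂ : ℝ) / d) * (1 - (b₂ : ℝ) / d) := by
      rw [← R.exponent_eq]
      refine lt_of_lt_of_le (rpow_product_lt hp1 hq1 hα0 hγ'α) ?_
      have := hfp la₂
      exact mul_le_mul (by linarith) (by linarith)
        (one_sub_rpow_neg_pos hq1 (by linarith)).le this
    rw [one_sub_div_eq hd la₂, one_sub_div_eq hd lb₂, div_mul_div_comm,
      div_lt_div_iff₀ two_pos (by positivity)] at h1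
    have : (d : ℝ) * d < 2 * (((d - a₂ : ℕ) : ℝ) * ((d - b₂ : ℕ) : ℝ)) := by linarith
    exact_mod_cast this
  · rw [pow_mul_pow_le_iff hv, ← div_le_rpow_neg_iff hp0 hd]
    exact he₁'.le
  · rw [le_pow_mul_pow_iff hv, ← rpow_neg_le_div_iff hp0 hd]
    exact he₂.le
  · rw [List.mem_range] at hk
    refine (lt_or_ge k N).imp_right fun hkN => ?_
    have hmem := Finset.mem_Icc.2 ⟨hkN, Nat.le_of_lt_succ hk⟩
    obtain ⟨⟨s1, s2⟩, -⟩ := hβ₀k k hmem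
    obtain ⟨-, s3, s4⟩ := hγ₀k k hmem
    have hk0 : (1 : ℝ) ≤ k := by exact_mod_cast (hN k hkN).1
    have hkβ : (k : ℝ) ^ β₀ ≤ (k : ℝ) ^ β := Real.rpow_le_rpow_of_exponent_le hk0 hu₁.le
    have hkγ : ((k : ℝ) + 2) ^ γ ≤ ((k : ℝ) + 2) ^ γ₀ :=
      Real.rpow_le_rpow_of_exponent_le (by linarith) hu₂'.le
    have t1 : 1 - (p : ℝ) ^ (-β₀) ≤ ((d - e₂ : ℕ) : ℝ) / d := by
      rw [← one_sub_div_eq hd le₂]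
      linarith
    have t2 : ((d - e₁ : ℕ) : ℝ) / d ≤ 1 - (p : ℝ) ^ (-γ₀) := by
      rw [← one_sub_div_eq hd le₁]
      linarith
    rw [le_div_iff₀ hd0] at t1
    rw [div_le_iff₀ hd0] at t2
    rw [le_pow_mul_pow_iff hv, le_pow_mul_pow_iff hv, pow_mul_pow_le_iff hv, pow_mul_pow_le_iff hv]
    change (_ ≤ _ * _ ^ β ∧ _ ≤ _ * _ ^ β) ∧ (_ * _ ^ γ ≤ _ ∧ _ * _ ^ γ ≤ _)
    push_cast
    have w2 := (one_sub_rpow_neg_pos hp1 hγ₀).le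
    have w1 := (one_sub_rpow_neg_pos hp1 hβ₀).le
    refine ⟨⟨s1.le.trans (by gcongr), ?_⟩, le_trans (by gcongr) s3.le, ?_⟩
    · calc (primitiveCount p q k : ℝ) * 2 ^ n * d
          ≤ (m + 1) * ((1 - (p : ℝ) ^ (-β₀)) * (k : ℝ) ^ β₀) * d := by gcongr
        _ = (m + 1) * ((1 - (p : ℝ) ^ (-β₀)) * d) * (k : ℝ) ^ β₀ := by ring
        _ ≤ _ := by gcongr
    · calc ((m - 1 : ℕ) : ℝ) * ((d - e₁ : ℕ) : ℝ) * ((k : ℝ) + 2) ^ γ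
          ≤ (m - 1 : ℕ) * ((1 - (p : ℝ) ^ (-γ₀)) * d) * ((k : ℝ) + 2) ^ γ₀ := by gcongr
        _ = (m - 1 : ℕ) * ((1 - (p : ℝ) ^ (-γ₀)) * ((k : ℝ) + 2) ^ γ₀) * d := by ring
        _ ≤ _ := by gcongr

/-! ### Primitive recursive checking and unbounded search -/

/-- The codes of candidates are tried in turn. A witness for every input makes the search total, so
the partial recursive function is computable. -/
theorem exists_computable_search {α W : Type*} [Primcodable α] [Primcodable W] {R : α → W → Prop}
    (hR : PrimrecRel R) (hex : ∀ a, ∃ w, R a w) : ∃ f : α → W, Computable f ∧ ∀ a, R a (f a) := by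
  classical
  let g : α → ℕ → Option W := fun a k =>
    (Encodable.decode (α := W) k).bind fun w => if R a w then some w else none
  have hg : Primrec₂ g := by
    refine Primrec.option_bind (Primrec.decode.comp Primrec.snd) ?_
    exact Primrec.ite (hR.comp (Primrec.fst.comp Primrec.fst) Primrec.snd)
      (Primrec.option_some.comp Primrec.snd) (Primrec.const none)
  have hdom : ∀ a, (Nat.rfindOpt (g a)).Dom := by
    intro a
    obtain ⟨w, hw⟩ := hex a
    exact Nat.rfindOpt_dom.2 ⟨Encodable.encode w, w, by simp [g, hw]⟩
  refine ⟨fun a => (Nat.rfindOpt (g a)).get (hdom a), ?_, fun a => ?_⟩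
  · exact (Partrec.rfindOpt hg.to_comp).of_eq fun a => (Part.some_get (hdom a)).symm
  · obtain ⟨k, hk⟩ := Nat.rfindOpt_spec (Part.get_mem (hdom a))
    simp only [g, Option.mem_def, Option.bind_eq_some_iff] at hk
    obtain ⟨w, -, hw⟩ := hk
    split_ifs at hw with h
    rw [Option.some.injEq] at hw
    subst hw
    exact h

/-- The code of the integer n ≥ 0 is 2 n. -/
theorem primrec_natCast_int : Primrec fun n : ℕ => (n : ℤ) := by
  refine Primrec.encode_iff.1 (Primrec.nat_double.of_eq fun n => ?_)
  rfl

theorem primrec_nat_pow : Primrec₂ fun a n : ℕ => a ^ n :=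
  (Primrec.nat_rec (Primrec.const 1) (Primrec.nat_mul.comp (Primrec.snd.comp Primrec.snd)
    Primrec.fst).to₂).of_eq fun a n => by
      induction n with
      | zero => rfl
      | succ n ih => simp only [pow_succ, ← ih]

/-- The values of `chainCount` and `primitiveCount` for the pair `(a + 2, b + 2)`, computed by
their recursion. -/
def countTable (a b : ℕ) : ℕ → ℕ × ℕ
  | 0 => (1, 0)
  | n + 1 =>
    have : (n + 1) / (a + 2) < n + 1 := Nat.div_lt_self (by omega) (by omega)
    have : (n + 1) / (b + 2) < n + 1 := Nat.div_lt_self (by omega) (by omega)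
    have : n / (a + 2) < n + 1 := Nat.lt_succ_of_le (Nat.div_le_self _ _)
    have : n / (b + 2) < n + 1 := Nat.lt_succ_of_le (Nat.div_le_self _ _)
    let r := (countTable a b (n / (a + 2))).1 + (countTable a b (n / (b + 2))).2 +
      (countTable a b ((n + 1) / (b + 2))).2
    (r + (countTable a b ((n + 1) / (a + 2))).1, r)

/-- The offset by 2 keeps both divisors above 1 for every input, so the recursion terminates without
hypotheses; for p, q > 1 it is undone here. -/
theorem countTable_eq {p q : ℕ} (hp : 1 < p) (hq : 1 < q) (hpq : p.Coprime q) (n : ℕ) :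
    countTable (p - 2) (q - 2) n = (chainCount p q n, primitiveCount p q n) := by
  induction n using Nat.strong_induction_on with
  | _ n ih =>
    rcases n with _ | n
    · rw [countTable, chainCount_zero hp hq, primitiveCount_zero hp hq]
    · have h1 : (n + 1) / p < n + 1 := Nat.div_lt_self (by omega) (by omega)
      have h2 : (n + 1) / q < n + 1 := Nat.div_lt_self (by omega) (by omega)
      have h3 : n / p < n + 1 := Nat.lt_succ_of_le (Nat.div_le_self _ _)
      have h4 : n / q < n + 1 := Nat.lt_succ_of_le (Nat.div_le_self _ _)
      rw [countTable, Nat.sub_add_cancel hp, Nat.sub_add_cancel hq, ih _ h1, ih _ h2, ih _ h3,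
        ih _ h4, chainCount_eq hp hpq (n + 1), primitiveCount_eq hp hq hpq (Nat.le_add_left 1 n),
        Nat.add_sub_cancel]

/-- One step of the recursion of `countTable`, from the list of the previous values. -/
def tableStep (a b : ℕ) (l : List (ℕ × ℕ)) : ℕ × ℕ :=
  if l.length = 0 then (1, 0) else
    ((l.getD ((l.length - 1) / (a + 2)) (0, 0)).1 + (l.getD ((l.length - 1) / (b + 2)) (0, 0)).2 +
      (l.getD (l.length / (b + 2)) (0, 0)).2 + (l.getD (l.length / (a + 2)) (0, 0)).1,
     (l.getD ((l.length - 1) / (a + 2)) (0, 0)).1 + (l.getD ((l.length - 1) / (b + 2)) (0, 0)).2 +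
      (l.getD (l.length / (b + 2)) (0, 0)).2)

theorem tableStep_eq (a b n : ℕ) :
    tableStep a b ((List.range n).map (countTable a b)) = countTable a b n := by
  rcases n with _ | n
  · simp [tableStep, countTable]
  · have hget : ∀ i, i < n + 1 →
        ((List.range (n + 1)).map (countTable a b)).getD i (0, 0) = countTable a b i := by
      intro i hi
      simp [List.getD, hi]
    have h1 : (n + 1) / (a + 2) < n + 1 := Nat.div_lt_self (by omega) (by omega)
    have h2 : (n + 1) / (b + 2) < n + 1 := Nat.div_lt_self (by omega) (by omega)
    have h3 : n / (a + 2) < n + 1 := Nat.lt_succ_of_le (Nat.div_le_self _ _)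
    have h4 : n / (b + 2) < n + 1 := Nat.lt_succ_of_le (Nat.div_le_self _ _)
    rw [tableStep, countTable, List.length_map, List.length_range, Nat.add_sub_cancel, hget _ h1,
      hget _ h2, hget _ h3, hget _ h4, if_neg (Nat.succ_ne_zero n)]

theorem primrec_tableStep : Primrec fun x : (ℕ × ℕ) × List (ℕ × ℕ) => tableStep x.1.1 x.1.2 x.2 := by
  have hl : Primrec fun x : (ℕ × ℕ) × List (ℕ × ℕ) => x.2.length :=
    Primrec.list_length.comp Primrec.snd
  have hl' : Primrec fun x : (ℕ × ℕ) × List (ℕ × ℕ) => x.2.length - 1 :=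
    Primrec.nat_sub.comp hl (Primrec.const 1)
  have ha : Primrec fun x : (ℕ × ℕ) × List (ℕ × ℕ) => x.1.1 + 2 :=
    Primrec.nat_add.comp (Primrec.fst.comp Primrec.fst) (Primrec.const 2)
  have hb : Primrec fun x : (ℕ × ℕ) × List (ℕ × ℕ) => x.1.2 + 2 :=
    Primrec.nat_add.comp (Primrec.snd.comp Primrec.fst) (Primrec.const 2)
  have hget : ∀ {f : (ℕ × ℕ) × List (ℕ × ℕ) → ℕ}, Primrec f →
      Primrec fun x : (ℕ × ℕ) × List (ℕ × ℕ) => x.2.getD (f x) (0, 0) := fun hf =>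
    (Primrec.list_getD (0, 0)).comp Primrec.snd hf
  have hr := Primrec.nat_add.comp
    (Primrec.nat_add.comp (Primrec.fst.comp (hget (Primrec.nat_div.comp hl' ha)))
      (Primrec.snd.comp (hget (Primrec.nat_div.comp hl' hb))))
    (Primrec.snd.comp (hget (Primrec.nat_div.comp hl hb)))
  exact Primrec.ite (Primrec.eq.comp hl (Primrec.const 0)) (Primrec.const (1, 0))
    (Primrec.pair (Primrec.nat_add.comp hr (Primrec.fst.comp (hget (Primrec.nat_div.comp hl ha))))
      hr)

/-- Course-of-values recursion: each entry is a primitive recursive function of the list of earlier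
ones. -/
theorem primrec_countTable : Primrec₂ fun (x : ℕ × ℕ) (n : ℕ) => countTable x.1 x.2 n :=
  Primrec.nat_strong_rec _ (Primrec.option_some.comp primrec_tableStep).to₂ fun x n =>
    congrArg some (tableStep_eq x.1 x.2 n)

/-- The acceptance condition of the search: `w` encodes a certificate, or it encodes a proof that
the pair is not admissible. -/
def Accepts (x : (ℕ × ℕ) × ℕ) (w : Fin 13 → ℕ) : Prop :=
  IsCertificate x.1.1 x.1.2 x.2 (fun k => (countTable (x.1.1 - 2) (x.1.2 - 2) k).1)
    (fun k => (countTable (x.1.1 - 2) (x.1.2 - 2) k).2)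
    (w 0) (w 1) (w 2) (w 3) (w 4) (w 5) (w 6) (w 7) (w 8) (w 9) (w 10) (w 11) ∨
  (x.1.1 ≤ 1 ∨ x.1.2 ≤ 1 ∨ (1 < w 12 ∧ x.1.1 % w 12 = 0 ∧ x.1.2 % w 12 = 0))

theorem primrecRel_isCertificate {X : Type*} [Primcodable X] {p q n : X → ℕ} {T Q : X → ℕ → ℕ}
    {m N v u₁ u₂ d a₁ b₁ a₂ b₂ e₁ e₂ : X → ℕ} (hp : Primrec p) (hq : Primrec q) (hn : Primrec n)
    (hT : Primrec₂ T) (hQ : Primrec₂ Q) (hm : Primrec m) (hN : Primrec N) (hv : Primrec v)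
    (hu₁ : Primrec u₁) (hu₂ : Primrec u₂) (hd : Primrec d) (ha₁ : Primrec a₁) (hb₁ : Primrec b₁)
    (ha₂ : Primrec a₂) (hb₂ : Primrec b₂) (he₁ : Primrec e₁) (he₂ : Primrec e₂) :
    PrimrecPred fun x => IsCertificate (p x) (q x) (n x) (T x) (Q x) (m x) (N x) (v x) (u₁ x) (u₂ x)
      (d x) (a₁ x) (b₁ x) (a₂ x) (b₂ x) (e₁ x) (e₂ x) := by
  have add : ∀ {Y : Type _} [Primcodable Y] {f g : Y → ℕ}, Primrec f → Primrec g →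
      Primrec fun y => f y + g y := fun hf hg => Primrec.nat_add.comp hf hg
  have sub : ∀ {Y : Type _} [Primcodable Y] {f g : Y → ℕ}, Primrec f → Primrec g →
      Primrec fun y => f y - g y := fun hf hg => Primrec.nat_sub.comp hf hg
  have mul : ∀ {Y : Type _} [Primcodable Y] {f g : Y → ℕ}, Primrec f → Primrec g →
      Primrec fun y => f y * g y := fun hf hg => Primrec.nat_mul.comp hf hg
  have pow : ∀ {Y : Type _} [Primcodable Y] {f g : Y → ℕ}, Primrec f → Primrec g →
      Primrec fun y => f y ^ g y := fun hf hg => primrec_nat_pow.comp hf hg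
  have le : ∀ {Y : Type _} [Primcodable Y] {f g : Y → ℕ}, Primrec f → Primrec g →
      PrimrecPred fun y => f y ≤ g y := fun hf hg => Primrec.nat_le.comp hf hg
  have lt : ∀ {Y : Type _} [Primcodable Y] {f g : Y → ℕ}, Primrec f → Primrec g →
      PrimrecPred fun y => f y < g y := fun hf hg => Primrec.nat_lt.comp hf hg
  have c : ∀ {Y : Type _} [Primcodable Y] (k : ℕ), Primrec fun _ : Y => k :=
    fun k => Primrec.const k
  have ext : ∀ {f : X → ℕ}, Primrec f → Primrec fun y : ℕ × X => f y.2 :=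
    fun hf => hf.comp Primrec.snd
  have hk : Primrec fun y : ℕ × X => y.1 := Primrec.fst
  have hTk : Primrec fun y : ℕ × X => T y.2 y.1 := hT.comp Primrec.snd Primrec.fst
  have hQk : Primrec fun y : ℕ × X => Q y.2 y.1 := hQ.comp Primrec.snd Primrec.fst
  have hwin : PrimrecPred fun y : ℕ × X => y.1 < N y.2 ∨
      (((T y.2 y.1 * 2 ^ n y.2) ^ v y.2 ≤ (m y.2 + 1) ^ v y.2 * y.1 ^ u₁ y.2 ∧
        (Q y.2 y.1 * 2 ^ n y.2 * d y.2) ^ v y.2 ≤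
          ((m y.2 + 1) * (d y.2 - e₂ y.2)) ^ v y.2 * y.1 ^ u₁ y.2) ∧
      ((m y.2 - 1) ^ v y.2 * (y.1 + 2) ^ u₂ y.2 ≤ (T y.2 y.1 * 2 ^ n y.2) ^ v y.2 ∧
        ((m y.2 - 1) * (d y.2 - e₁ y.2)) ^ v y.2 * (y.1 + 2) ^ u₂ y.2 ≤
          (Q y.2 y.1 * 2 ^ n y.2 * d y.2) ^ v y.2)) := by
    have hT2 := mul hTk (pow (c 2) (ext hn))
    have hQ2 := mul (mul hQk (pow (c 2) (ext hn))) (ext hd)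
    refine (lt hk (ext hN)).or (((le (pow hT2 (ext hv)) ?_).and (le (pow hQ2 (ext hv)) ?_)).and
      ((le ?_ (pow hT2 (ext hv))).and (le ?_ (pow hQ2 (ext hv)))))
    · exact mul (pow (add (ext hm) (c 1)) (ext hv)) (pow hk (ext hu₁))
    · exact mul (pow (mul (add (ext hm) (c 1)) (sub (ext hd) (ext he₂))) (ext hv)) (pow hk (ext hu₁))
    · exact mul (pow (sub (ext hm) (c 1)) (ext hv)) (pow (add hk (c 2)) (ext hu₂))
    · exact mul (pow (mul (sub (ext hm) (c 1)) (sub (ext hd) (ext he₁))) (ext hv))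
        (pow (add hk (c 2)) (ext hu₂))
  have hall := (PrimrecPred.primrecRel hwin).forall_mem_list.comp
    (Primrec.list_range.comp (add (mul (mul (c 2) (mul hp hq)) hN) (c 1))) Primrec.id
  refine ((lt (c 0) hN).and ((lt (c 0) hv).and (lt (c 0) hd))).and
    (((le (mul (pow ha₁ hv) (pow hp hu₁)) (pow hd hv)).and
      ((le (mul (pow hb₁ hv) (pow hq hu₁)) (pow hd hv)).and
        (lt (mul (c 2) (mul (sub hd ha₁) (sub hd hb₁))) (mul hd hd)))).and
    (((le (pow hd hv) (mul (pow ha₂ hv) (pow hp hu₂))).and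
      ((le (pow hd hv) (mul (pow hb₂ hv) (pow hq hu₂))).and
        (lt (mul hd hd) (mul (c 2) (mul (sub hd ha₂) (sub hd hb₂)))))).and
    (((le (mul (pow he₁ hv) (pow hp hu₂)) (pow hd hv)).and
      (le (pow hd hv) (mul (pow he₂ hv) (pow hp hu₁)))).and hall)))

theorem primrecRel_accepts : PrimrecRel Accepts := by
  have hp : Primrec fun y : ((ℕ × ℕ) × ℕ) × (Fin 13 → ℕ) => y.1.1.1 :=
    Primrec.fst.comp (Primrec.fst.comp Primrec.fst)
  have hq : Primrec fun y : ((ℕ × ℕ) × ℕ) × (Fin 13 → ℕ) => y.1.1.2 :=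
    Primrec.snd.comp (Primrec.fst.comp Primrec.fst)
  have hn : Primrec fun y : ((ℕ × ℕ) × ℕ) × (Fin 13 → ℕ) => y.1.2 :=
    Primrec.snd.comp Primrec.fst
  have hw : ∀ i : Fin 13, Primrec fun y : ((ℕ × ℕ) × ℕ) × (Fin 13 → ℕ) => y.2 i :=
    fun i => Primrec.fin_app.comp Primrec.snd (Primrec.const i)
  have htab : Primrec₂ fun (y : ((ℕ × ℕ) × ℕ) × (Fin 13 → ℕ)) (k : ℕ) =>
      countTable (y.1.1.1 - 2) (y.1.1.2 - 2) k :=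
    primrec_countTable.comp (Primrec.pair
      (Primrec.nat_sub.comp (hp.comp Primrec.fst) (Primrec.const 2))
      (Primrec.nat_sub.comp (hq.comp Primrec.fst) (Primrec.const 2))) Primrec.snd
  have hcert := primrecRel_isCertificate hp hq hn (Primrec.fst.comp htab).to₂
    (Primrec.snd.comp htab).to₂ (hw 0) (hw 1) (hw 2) (hw 3) (hw 4) (hw 5) (hw 6) (hw 7) (hw 8)
    (hw 9) (hw 10) (hw 11)
  exact hcert.or ((Primrec.nat_le.comp hp (Primrec.const 1)).or
    ((Primrec.nat_le.comp hq (Primrec.const 1)).or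
    ((Primrec.nat_lt.comp (Primrec.const 1) (hw 12)).and
      ((Primrec.eq.comp (Primrec.nat_mod.comp hp (hw 12)) (Primrec.const 0)).and
        (Primrec.eq.comp (Primrec.nat_mod.comp hq (hw 12)) (Primrec.const 0))))))

/-- The search must halt on inadmissible pairs too. For a pair that is not coprime the gcd, in
coordinate 12, is the witness. -/
theorem exists_accepts (x : (ℕ × ℕ) × ℕ) : ∃ w, Accepts x w := by
  obtain ⟨⟨p, q⟩, n⟩ := x
  by_cases hp : 1 < p
  swap
  · exact ⟨0, Or.inr (Or.inl (not_lt.1 hp))⟩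
  by_cases hq : 1 < q
  swap
  · exact ⟨0, Or.inr (Or.inr (Or.inl (not_lt.1 hq)))⟩
  by_cases hpq : p.Coprime q
  · obtain ⟨C, α, hC, hα, hup, hlow⟩ := exists_limit_chainCount hp hq hpq
    obtain ⟨m, N, v, u₁, u₂, d, a₁, b₁, a₂, b₂, e₁, e₂, h⟩ :=
      exists_isCertificate n hp hq hpq hC hα hup hlow
    refine ⟨![m, N, v, u₁, u₂, d, a₁, b₁, a₂, b₂, e₁, e₂, 0], Or.inl ?_⟩
    simp only [countTable_eq hp hq hpq]
    exact h
  · refine ⟨fun _ => p.gcd q, Or.inr (Or.inr (Or.inr ⟨?_, ?_, ?_⟩))⟩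
    · have h0 : 0 < p.gcd q := Nat.gcd_pos_of_pos_left q (by omega)
      have h1 : p.gcd q ≠ 1 := hpq
      change 1 < p.gcd q
      omega
    · exact Nat.mod_eq_zero_of_dvd (Nat.gcd_dvd_left p q)
    · exact Nat.mod_eq_zero_of_dvd (Nat.gcd_dvd_right p q)

theorem Accepts.isCertificate {p q n : ℕ} {w : Fin 13 → ℕ} (hp : 1 < p) (hq : 1 < q)
    (hpq : p.Coprime q) (h : Accepts ((p, q), n) w) :
    IsCertificate p q n (chainCount p q) (primitiveCount p q)
      (w 0) (w 1) (w 2) (w 3) (w 4) (w 5) (w 6) (w 7) (w 8) (w 9) (w 10) (w 11) := by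
  rcases h with h | h | h | ⟨h1, h2, h3⟩
  · simpa only [countTable_eq hp hq hpq] using h
  · exact absurd h (not_le.2 hp)
  · exact absurd h (not_le.2 hq)
  · have := Nat.dvd_gcd (Nat.dvd_of_mod_eq_zero h2) (Nat.dvd_of_mod_eq_zero h3)
    have hgcd : p.gcd q = 1 := hpq
    simp only [hgcd, Nat.dvd_one] at this
    omega

/-! ### The theorem -/

theorem mainTheorem1 :
    ∃ C : ℕ × ℕ → ℝ, IsComputableRealOn admissiblePairs C ∧
      ∀ p q : ℕ, 1 < p → 1 < q → Nat.Coprime p q →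
        (∃! α : ℝ, IsPositiveExponent p q α) ∧
        ∀ α : ℝ, IsPositiveExponent p q α →
          0 < C (p, q) ∧
          (chainedSum p q) ~[Filter.atTop] (fun x : ℝ => C (p, q) * x ^ α) ∧
          C (p, q) < 2 * (Real.log ((p : ℝ) ^ α) / ((p : ℝ) ^ α - 1) +
            Real.log ((q : ℝ) ^ α) / ((q : ℝ) ^ α - 1))⁻¹ := by
  have hlim : ∀ x : ℕ × ℕ, ∃ C : ℝ, x ∈ admissiblePairs →
      0 < C ∧ ∃ α : ℝ, IsPositiveExponent x.1 x.2 α ∧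
      (∀ A, C < A → RenewalPair.IsEventualUpper x.1 α (fun y => chainCount x.1 x.2 ⌊y⌋₊)
        (fun y => primitiveCount x.1 x.2 ⌊y⌋₊) A) ∧
      ∀ B, 0 < B → B < C → RenewalPair.IsEventualLower x.1 α
        (fun y => chainCount x.1 x.2 ⌊y⌋₊) (fun y => primitiveCount x.1 x.2 ⌊y⌋₊) B := by
    intro x
    by_cases hx : x ∈ admissiblePairs
    · obtain ⟨C, α, hC, hα, h⟩ := exists_limit_chainCount hx.1 hx.2.1 hx.2.2
      exact ⟨C, fun _ => ⟨hC, α, hα, h⟩⟩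
    · exact ⟨0, fun h => absurd h hx⟩
  choose C hC using hlim
  obtain ⟨f, hf, hfA⟩ := exists_computable_search primrecRel_accepts exists_accepts
  -- Coordinate 0 of the certificate found is the numerator m.
  refine ⟨C, ⟨fun x => (f x 0 : ℤ), ?_, ?_⟩, ?_⟩
  · exact primrec_natCast_int.to_comp.comp
      ((Primrec.fin_app.comp Primrec.id (Primrec.const 0)).to_comp.comp hf)
  · rintro ⟨p, q⟩ hx n
    obtain ⟨-, α, hα, hup, hlow⟩ := hC _ hx
    have := ((hfA ((p, q), n)).isCertificate hx.1 hx.2.1 hx.2.2).abs_sub_le hx.1 hx.2.1 hx.2.2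
      hα hup hlow
    simpa using this
  · intro p q hp hq hpq
    have huniq := existsUnique_isPositiveExponent hp hq
    refine ⟨huniq, fun α hα => ?_⟩
    obtain ⟨hC0, α', hα', hup, hlow⟩ := hC (p, q) ⟨hp, hq, hpq⟩
    obtain rfl := huniq.unique hα' hα
    exact ⟨hC0, isEquivalent_chainedSum hp hq hC0 hα'.1 hup hlow,
      limit_lt hp hq hpq hC0 hα' hlow⟩
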